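/- **Setting.** A *Busemann space* is a geodesic metric space $X$ such that for any two (unit speed) geodesics $\gamma\colon[a,b]\to X$, $\gamma'\colon[a',b']\to X$ the function $(t,t')\mapsto d(\gamma(t),\gamma'(t'))$ is convex on $[a,b]\times[a',b']$. Let $n\ge 1$, and for each $1\le i\le n$ let $(X_i,o_i,W_i)$ be one of the following. (a) $X_i$ is a proper Busemann space, $o_i\in X_i$, and $W_i$ is its visual boundary, the set of geodesic rays $[0,\infty)\to X_i$ starting at $o_i$. For $x\in X_i$ the extended geodesic $t\mapsto x(t)$ is the geodesic from $o_i$ to $x$ for $t\le d(o_i,x)$, and $x(t)=x$ for $t\geq d(o_i,x)$. The set $\overline{X_i}=X_i\cup W_i$ is topologized as a subspace of $C([0,\infty),X_i)$ (uniform convergence on compact sets), each $x\in X_i$ being identified with its extended geodesic. (b) $W_i$ is a nonempty compact subset of the unit sphere of a real Hilbert space $E_i$, $X_i=\mathrm{Pen}(\mathcal OW_i,d_i)$ is the closed $d_i$-neighborhood of the open cone $\mathcal OW_i=\{tw: t\ge 0,\ w\in W_i\}$ for some $d_i\ge 0$, and $o_i=0$ is the apex. The set $\overline{X_i}=X_i\cup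 W_i$ is topologized by identifying it with $\Lambda(X_i)\cup W_i\subset E_i$, where $\Lambda(v)=\frac{\|v\|}{1+\|v\|}\frac{v}{\|v\|}$ (and $\Lambda(0)=0$). For $0\le t<\infty$ put $x(t)=\min\{t,\|x\|\}\frac{x}{\|x\|}$ for $x\in X_i$ (with $x(t)=0$ if $x=0$) and $w(t)=tw$ for $w\in W_i$. Put $|x_i|=d(x_i,o_i)$ for $x_i\in X_i$, and equip $\prod_i X_i$ with the $\ell^1$-metric. The join $\overline{X_1}\star\dots\star\overline{X_n}$ is the quotient space of $\{(t_i,x_i)_i\in\prod_i([0,1]\times\overline{X_i}):\sum_i t_i=1\}$ by the relation identifying $(t_i,x_i)_i$ with $(s_i,y_i)_i$ if $t_i=s_i$ for all $i$ and $x_i=y_i$ whenever $t_i\ne0$; classes are written $\oplus t_ix_i$. Its subset $W_1\star\dots\star W_n$ consists of the classes $\oplus t_ix_i$ with $x_i\in W_i$ whenever $t_i\neq 0$. Let $$\iota\colon\prod_i X_i\to\overline{X_1}\star\dots\star\overline{X_n},\qquad \iota(x_1,\dots,x_n)=\oplus\, t_ix_i,\quad t_i=\frac{1+|x_i|}{\sum_j(1+|x_j|)},$$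 and let $\overline{\prod_i X_i}$ be the closure of the image of $\iota$. **Theorem.** The space $\overline{\prod_i X_i}$, with the map $\iota$, is a compactification at infinity of $\prod_i X_i$: it is Hausdorff, $\iota$ is an embedding onto an open subset, closed bounded subsets of $\prod_i X_i$ have closed image in it, and the complement of the image of $\iota$ is compact. It equals $\iota(\prod_i X_i)\cup W_1\star\dots\star W_n$, and it is contractible. More precisely, there is a continuous map $H\colon\overline{\prod_i X_i}\times[0,\infty]\to\overline{\prod_i X_i}$ such that $$H(\oplus t_ix_i,t)=\iota\bigl(x_1(t_1t),\dots,x_n(t_nt)\bigr)=\oplus\frac{1+|x_i(t_it)|}{\sum_j(1+|x_j(t_jt)|)}\,x_i(t_it)\qquad(0\le t<\infty),$$ $H(\cdot,0)$ is constant with value $\iota(o_1,\dots,o_n)=\oplus\frac1n o_i$, and $H(\cdot,\infty)$ is the identity. -/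

import Mathlib

open scoped NNReal ENNReal unitInterval

universe u

/-! ## Compactifications at infinity -/

/-- `i : X → Y` exhibits `Y` as a compactification at infinity of the metric space `X`. -/
structure IsCompactificationAtInfinity {X : Type*} [MetricSpace X] {Y : Type*}
    [TopologicalSpace Y] (i : X → Y) : Prop where
  t2 : T2Space Y
  isOpenEmbedding : Topology.IsOpenEmbedding i
  isClosed_image : ∀ A : Set X, IsClosed A → Bornology.IsBounded A → IsClosed (i '' A)
  isCompact_compl : IsCompact (Set.range i)ᶜ

/-! ## Finite joins -/

namespace FiniteJoin

variable {n : ℕ}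

/-- The set `Ω` of all `(t₁, x₁, …, tₙ, xₙ)` in `∏ ([0,1] × Zᵢ)` with `∑ tᵢ = 1`. -/
def Omega (Z : Fin n → Type u) : Type u :=
  {p : ∀ i, I × Z i // ∑ i, ((p i).1 : ℝ) = 1}

instance (Z : Fin n → Type u) [∀ i, TopologicalSpace (Z i)] : TopologicalSpace (Omega Z) :=
  inferInstanceAs (TopologicalSpace {p : ∀ i, I × Z i // ∑ i, ((p i).1 : ℝ) = 1})

/-- Two points of `Ω` are identified when their weights agree and their points agree wherever the
weight does not vanish. -/
def setoid (Z : Fin n → Type u) : Setoid (Omega Z) where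
  r p q := ∀ i, (p.1 i).1 = (q.1 i).1 ∧ ((p.1 i).2 ≠ (q.1 i).2 → (p.1 i).1 = 0)
  iseqv :=
    { refl := fun p i => ⟨rfl, fun h => (h rfl).elim⟩
      symm := fun {p q} h i => ⟨(h i).1.symm, fun hne => (h i).1 ▸ (h i).2 hne.symm⟩
      trans := fun {p q r} h k i => ⟨(h i).1.trans (k i).1, fun hne => by
        by_cases hpq : (p.1 i).2 = (q.1 i).2
        · rw [(h i).1]; exact (k i).2 (hpq ▸ hne)
        · exact (h i).2 hpq⟩ }

/-- The join `Z₁ ⋆ … ⋆ Zₙ`. -/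
def Join (Z : Fin n → Type u) : Type u := Quotient (setoid Z)

/-- The join carries the quotient topology. -/
instance (Z : Fin n → Type u) [∀ i, TopologicalSpace (Z i)] : TopologicalSpace (Join Z) :=
  inferInstanceAs (TopologicalSpace (Quotient (setoid Z)))

/-- The class `t₁x₁ ⊕ … ⊕ tₙxₙ`. -/
def mk {Z : Fin n → Type u} (p : Omega Z) : Join Z := Quotient.mk (setoid Z) p

/-- The join `S₁ ⋆ … ⋆ Sₙ` of subsets `Sᵢ ⊆ Zᵢ` as a subset of `Z₁ ⋆ … ⋆ Zₙ`: all `⊕ tᵢxᵢ` with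
`xᵢ ∈ Sᵢ` whenever `tᵢ ≠ 0` (thus `∅` is neutral for the join of subsets). -/
def sub {Z : Fin n → Type u} (S : ∀ i, Set (Z i)) : Set (Join Z) :=
  {z | ∃ p : Omega Z, mk p = z ∧ ∀ i, (p.1 i).1 ≠ 0 → (p.1 i).2 ∈ S i}

/-- The natural map from the join of subsets to the join of the ambient spaces. -/
def inclusion {Z : Fin n → Type u} (S : ∀ i, Set (Z i)) :
    Join (fun i => (S i : Type u)) → Join Z :=
  Quotient.map' (s₁ := setoid _) (s₂ := setoid _)
    (fun p => ⟨fun i => ((p.1 i).1, ((p.1 i).2 : Z i)), p.2⟩)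
    (fun _ _ h i => ⟨(h i).1, fun hne => (h i).2 fun he => hne (congrArg Subtype.val he)⟩)

/-- For nonempty subsets, `sub S` is the image of the join of the spaces `Sᵢ`. -/
theorem sub_eq_range_inclusion {Z : Fin n → Type u} (S : ∀ i, Set (Z i))
    (hS : ∀ i, (S i).Nonempty) : sub S = Set.range (inclusion S) := by
  classical
  ext z
  constructor
  · rintro ⟨p, rfl, hp⟩
    let y : ∀ i, S i := fun i =>
      if h : (p.1 i).2 ∈ S i then ⟨(p.1 i).2, h⟩ else ⟨(hS i).some, (hS i).some_mem⟩
    refine ⟨mk ⟨fun i => ((p.1 i).1, y i), p.2⟩, ?_⟩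
    refine Quotient.sound (s := setoid Z) fun i => ⟨rfl, fun hne => ?_⟩
    by_contra h0
    exact hne (by simp [y, hp i h0])
  · rintro ⟨w, rfl⟩
    induction w using Quotient.inductionOn with
    | h p => exact ⟨⟨fun i => ((p.1 i).1, ((p.1 i).2 : Z i)), p.2⟩, rfl, fun i _ => (p.1 i).2.2⟩

end FiniteJoin

/-! ## Pointed metric spaces with a boundary at infinity and extended geodesics -/

/-- The data which a Busemann space and a neighbourhood of an open cone provide: a metric space
with a base point, a boundary, a topology on the disjoint union of the two, and, for each point of
this union, the extended geodesic from the base point to it, at finite times. -/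
structure Bordification where
  carrier : Type u
  metric : MetricSpace carrier
  base : carrier
  boundary : Type u
  topology : TopologicalSpace (carrier ⊕ boundary)
  geo : carrier ⊕ boundary → ℝ≥0 → carrier

namespace Bordification

instance (B : Bordification.{u}) : MetricSpace B.carrier := B.metric

/-- The space `X̄ = X ∪ ∂X`, with the topology which is part of the data. -/
def Total (B : Bordification.{u}) : Type u := B.carrier ⊕ B.boundary

instance (B : Bordification.{u}) : TopologicalSpace B.Total := B.topology

/-- The inclusion of `X` into `X̄`. -/
def incl (B : Bordification.{u}) (x : B.carrier) : B.Total := Sum.inl x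

/-- The boundary `∂X = X̄ ∖ X` as a subset of `X̄`. -/
def bdry (B : Bordification.{u}) : Set B.Total := Set.range Sum.inr

/-- The point `x(t)` on the extended geodesic to `x ∈ X̄`. -/
def point (B : Bordification.{u}) (x : B.Total) (t : ℝ≥0) : B.carrier := B.geo x t

section Factors

variable {n : ℕ} (B : Fin n → Bordification.{u})

/-- The product `∏ Xᵢ` with the `ℓ¹`-metric. -/
abbrev Product : Type u := PiLp 1 fun i => (B i).carrier

/-- `1 + |xᵢ|`, where `|xᵢ|` is the distance to the base point. -/
noncomputable def height (x : Product B) (i : Fin n) : ℝ := 1 + dist (x i) (B i).base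

/-- `tᵢ(x) = (1 + |xᵢ|) / ∑ⱼ (1 + |xⱼ|)`. -/
noncomputable def weight (x : Product B) (i : Fin n) : ℝ := height B x i / ∑ j, height B x j

theorem height_pos (x : Product B) (i : Fin n) : 0 < height B x i := by
  unfold height; positivity

theorem weight_mem (x : Product B) (i : Fin n) : weight B x i ∈ I := by
  have h0 : ∀ j, 0 ≤ height B x j := fun j => (height_pos B x j).le
  refine ⟨div_nonneg (h0 i) (Finset.sum_nonneg fun j _ => h0 j), ?_⟩
  exact div_le_one_of_le₀ (Finset.single_le_sum (fun j _ => h0 j) (Finset.mem_univ i))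
    (Finset.sum_nonneg fun j _ => h0 j)

theorem sum_weight [NeZero n] (x : Product B) : ∑ i, weight B x i = 1 := by
  unfold weight
  rw [← Finset.sum_div]
  exact div_self (Finset.sum_pos (fun j _ => height_pos B x j) Finset.univ_nonempty).ne'

/-- The embedding `ι(x₁, …, xₙ) = t₁x₁ ⊕ … ⊕ tₙxₙ` of the product into the join of the `X̄ᵢ`. -/
noncomputable def embed [NeZero n] (x : Product B) : FiniteJoin.Join fun i => (B i).Total :=
  FiniteJoin.mk ⟨fun i => (⟨weight B x i, weight_mem B x i⟩, (B i).incl (x i)), sum_weight B x⟩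

/-- The compactification at infinity of the product: the closure of the image of `ι`. -/
def prodClosure [NeZero n] : Set (FiniteJoin.Join fun i => (B i).Total) :=
  closure (Set.range (embed B))

/-- The map `ι` with values in the closure of its image. -/
noncomputable def embedClosure [NeZero n] (x : Product B) : prodClosure B :=
  ⟨embed B x, subset_closure (Set.mem_range_self x)⟩

end Factors

end Bordification

/-! ## Busemann spaces and their visual boundary -/

/-- `γ` restricts to a geodesic `[a, b] → X`. -/
def IsGeodesicOn {X : Type*} [MetricSpace X] (γ : ℝ → X) (a b : ℝ) : Prop :=
  ∀ s ∈ Set.Icc a b, ∀ t ∈ Set.Icc a b, dist (γ s) (γ t) = |s - t|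

/-- Any two points of `X` are joined by a geodesic. -/
def IsGeodesicSpace (X : Type*) [MetricSpace X] : Prop :=
  ∀ x y : X, ∃ γ : ℝ → X, IsGeodesicOn γ 0 (dist x y) ∧ γ 0 = x ∧ γ (dist x y) = y

/-- A Busemann space: a geodesic space in which `(t, t') ↦ dist (γ t) (γ' t')` is convex for any
two geodesics `γ : [a, b] → X` and `γ' : [a', b'] → X`. -/
structure IsBusemannSpace (X : Type*) [MetricSpace X] : Prop where
  geodesic : IsGeodesicSpace X
  convex : ∀ (γ γ' : ℝ → X) (a b a' b' : ℝ), IsGeodesicOn γ a b → IsGeodesicOn γ' a' b' →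
    ConvexOn ℝ (Set.Icc a b ×ˢ Set.Icc a' b') fun p : ℝ × ℝ => dist (γ p.1) (γ' p.2)

namespace IsBusemannSpace

variable {X : Type u} [MetricSpace X]

/-- The extended geodesic `φ(x)` from `o` to `x`: the geodesic from `o` to `x`, which is unique,
on `[0, |x|]`, and constantly `x` afterwards. -/
noncomputable def extGeodesic (hX : IsBusemannSpace X) (o x : X) : C(ℝ≥0, X) where
  toFun t := (hX.geodesic o x).choose (min (t : ℝ) (dist o x))
  continuous_toFun := by
    have hγ := (hX.geodesic o x).choose_spec.1
    have hm : ∀ t : ℝ≥0, min (t : ℝ) (dist o x) ∈ Set.Icc 0 (dist o x) := fun t =>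
      ⟨le_min t.2 dist_nonneg, min_le_right _ _⟩
    refine Metric.continuous_iff.2 fun b ε hε => ?_
    have hc : Continuous fun t : ℝ≥0 => min (t : ℝ) (dist o x) := by fun_prop
    obtain ⟨δ, hδ, h⟩ := Metric.continuous_iff.1 hc b ε hε
    exact ⟨δ, hδ, fun a ha => by
      rw [hγ _ (hm a) _ (hm b), ← Real.dist_eq]; exact h a ha⟩

/-- The visual boundary: geodesic rays `[0, ∞) → X` with base point `o`. -/
def VisualBoundary (o : X) : Type u := {c : C(ℝ≥0, X) // c 0 = o ∧ Isometry c}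

/-- The identification of `X ∪ ∂X` with `φ(X) ∪ ∂X ⊆ C([0, ∞), X)`. -/
noncomputable def toPath (hX : IsBusemannSpace X) (o : X) : X ⊕ VisualBoundary o → C(ℝ≥0, X) :=
  Sum.elim (hX.extGeodesic o) Subtype.val

/-- A Busemann space with its visual boundary; the topology on `X ∪ ∂X` is the one of uniform
convergence on compact sets on `C([0, ∞), X)`. -/
noncomputable def bordification (hX : IsBusemannSpace X) (o : X) : Bordification.{u} where
  carrier := X
  metric := inferInstance
  base := o
  boundary := VisualBoundary o
  topology := TopologicalSpace.induced (hX.toPath o) inferInstance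
  geo x t := hX.toPath o x t

end IsBusemannSpace

/-! ## Open cones -/

namespace OpenCone

open scoped Pointwise

variable {E : Type u} [NormedAddCommGroup E] [InnerProductSpace ℝ E]

/-- The open cone `𝒪W`: all nonnegative multiples of points of `W`. -/
def openCone (W : Set E) : Set E := {v | ∃ t : ℝ, 0 ≤ t ∧ ∃ w ∈ W, v = t • w}

/-- `Pen(𝒪W, d)`: the closed `d`-neighbourhood of the open cone. -/
def Pen (W : Set E) (d : ℝ) : Set E := Metric.cthickening d (openCone W)

theorem openCone_subset_pen (W : Set E) (d : ℝ) : openCone W ⊆ Pen W d :=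
  Metric.self_subset_cthickening _

theorem zero_mem_openCone {W : Set E} (hne : W.Nonempty) : (0 : E) ∈ openCone W :=
  ⟨0, le_rfl, hne.some, hne.some_mem, by simp⟩

theorem smul_mem_openCone {W : Set E} {c : ℝ} (hc : 0 ≤ c) {v : E} (hv : v ∈ openCone W) :
    c • v ∈ openCone W := by
  obtain ⟨t, ht, w, hw, rfl⟩ := hv
  exact ⟨c * t, mul_nonneg hc ht, w, hw, by rw [mul_smul]⟩

theorem smul_mem_pen {W : Set E} (hne : W.Nonempty) {d : ℝ} {v : E} (hv : v ∈ Pen W d)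
    {c : ℝ} (h0 : 0 ≤ c) (h1 : c ≤ 1) : c • v ∈ Pen W d := by
  rcases h0.eq_or_lt with rfl | hc
  · simpa using openCone_subset_pen W d (zero_mem_openCone hne)
  · rw [Pen, Metric.mem_cthickening_iff] at hv ⊢
    have hsub : c • openCone W ⊆ openCone W := by
      rintro _ ⟨u, hu, rfl⟩
      exact smul_mem_openCone h0 hu
    calc Metric.infEDist (c • v) (openCone W)
        ≤ Metric.infEDist (c • v) (c • openCone W) := Metric.infEDist_anti hsub
      _ = ‖c‖₊ • Metric.infEDist v (openCone W) := infEDist_smul₀ hc.ne' _ _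
      _ ≤ Metric.infEDist v (openCone W) := by
        have hc1 : ‖c‖₊ ≤ 1 := by
          rw [← NNReal.coe_le_coe]
          simpa [abs_of_pos hc] using h1
        rw [ENNReal.smul_def, smul_eq_mul]
        exact mul_le_of_le_one_left' (by exact_mod_cast hc1)
      _ ≤ ENNReal.ofReal d := hv

/-- `Λ(v) = λ(‖v‖) v / ‖v‖` with `λ(t) = t / (1 + t)`. -/
noncomputable def shrink (v : E) : E := (‖v‖ / (1 + ‖v‖)) • (‖v‖⁻¹ • v)

/-- The identification of `Pen(𝒪W, d) ∪ W` with `Λ(Pen(𝒪W, d)) ∪ W ⊆ E`. -/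
noncomputable def toBall (W : Set E) (d : ℝ) : Pen W d ⊕ W → E :=
  Sum.elim (fun v => shrink (v : E)) Subtype.val

/-- The extended geodesics: `x(t) = min(t, ‖x‖) x / ‖x‖` for `x ∈ Pen(𝒪W, d)` and `w(t) = t w`
for `w ∈ W`. -/
noncomputable def geo (W : Set E) (hne : W.Nonempty) (d : ℝ) :
    Pen W d ⊕ W → ℝ≥0 → Pen W d
  | .inl x, t => ⟨min (t : ℝ) ‖(x : E)‖ • (‖(x : E)‖⁻¹ • (x : E)), by
      rw [smul_smul, ← div_eq_mul_inv]
      exact smul_mem_pen hne x.2 (by positivity)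
        (div_le_one_of_le₀ (min_le_right _ _) (norm_nonneg _))⟩
  | .inr w, t => ⟨(t : ℝ) • (w : E), openCone_subset_pen W d ⟨t, t.2, w, w.2, rfl⟩⟩

/-- The space `Pen(𝒪W, d)` with the apex as base point and with boundary `W`; the topology on
`Pen(𝒪W, d) ∪ W` is the one of `Λ(Pen(𝒪W, d)) ∪ W ⊆ E`. -/
noncomputable def bordification (W : Set E) (hne : W.Nonempty) (d : ℝ) : Bordification.{u} where
  carrier := Pen W d
  metric := inferInstance
  base := ⟨0, openCone_subset_pen W d (zero_mem_openCone hne)⟩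
  boundary := W
  topology := TopologicalSpace.induced (toBall W d) inferInstance
  geo := geo W hne d

end OpenCone

/-! ## The factors -/

/-- A factor is either a proper Busemann space with a base point, or `Pen(𝒪W, d)` for a nonempty
compact subset `W` of the unit sphere of a real Hilbert space and some `d ≥ 0`. -/
inductive Factor : Type (u + 1)
  | busemann (X : Type u) [MetricSpace X] [ProperSpace X] (hX : IsBusemannSpace X) (o : X)
  | cone (E : Type u) [NormedAddCommGroup E] [InnerProductSpace ℝ E] [CompleteSpace E]
      (W : Set E) (hW : IsCompact W) (hS : W ⊆ Metric.sphere 0 1) (hne : W.Nonempty)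
      (d : ℝ) (hd : 0 ≤ d)

/-- The metric space, base point, boundary, topology and extended geodesics of a factor. -/
noncomputable def Factor.bordification : Factor.{u} → Bordification.{u}
  | @Factor.busemann _ _ _ hX o => hX.bordification o
  | @Factor.cone _ _ _ _ W _ _ hne d _ => OpenCone.bordification W hne d

open Filter Topology

/-! The function `1 / (1 + |x|)` on each factor, extended by zero to the boundary, is continuous on
the bordification (`continuous_invHeight`). Its product with the `i`-th weight is therefore a
continuous function on the join (`wtMul`). The image of the product space consists of the points
where these `n` functions share a positive value, the common value at `x` being the inverse of the
sum of the heights. The join of the boundaries is where they all vanish. So the locus `balanced`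
where they agree is closed and equals the union in question (`balanced_eq`). Openness of the image,
and closedness of images of closed bounded sets, come from bounding these functions from below.

The deformation moves each coordinate along its extended geodesic, with its weight as speed. At
finite times it lands in the image, so once it is continuous at time `⊤` the balanced locus lies in
the closure (`prodClosure_eq_balanced`). Continuity there has two ingredients. On balanced points
the weights converge uniformly, with error at most `n / t` (`abs_weight_endpoint_sub_le`). A
coordinate of nonzero weight is carried for a time tending to infinity and hence converges to its
endpoint, while one of weight zero may stop anywhere without affecting the class
(`continuousOn_preContraction`). Continuity descends from representatives to the join because
quotient maps restrict to closed saturated sets and stay quotient maps after multiplication by `[0,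
∞]`.

Only the properties collected in `IsCombed` are used in this argument. They hold for proper Busemann
spaces by convexity of the distance, and for neighbourhoods of cones by explicit formulas in the
ball. -/

theorem Topology.IsQuotientMap.restrictPreimage_isClosed {X Y : Type*} [TopologicalSpace X]
    [TopologicalSpace Y] {f : X → Y} (hf : IsQuotientMap f) {s : Set Y} (hs : IsClosed s) :
    IsQuotientMap (s.restrictPreimage f) := by
  refine isQuotientMap_iff_isClosed.2 ⟨hf.surjective.restrictPreimage _, fun t => ?_⟩
  rw [hs.isClosedEmbedding_subtypeVal.isClosed_iff_image_isClosed, ← hf.isClosed_preimage,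
    (hs.preimage hf.continuous).isClosedEmbedding_subtypeVal.isClosed_iff_image_isClosed,
    Set.image_val_preimage_restrictPreimage]

/-! ### Topology of finite joins -/

namespace FiniteJoin

variable {n : ℕ} {Z : Fin n → Type u}

theorem mk_surjective : Function.Surjective (mk : Omega Z → Join Z) := Quotient.mk_surjective

theorem mk_eq_mk_iff {p q : Omega Z} :
    mk p = mk q ↔ ∀ i, (p.1 i).1 = (q.1 i).1 ∧ ((p.1 i).2 ≠ (q.1 i).2 → (p.1 i).1 = 0) :=
  Quotient.eq (r := setoid Z)

/-- The `i`-th weight of a point of the join. -/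
def wt (i : Fin n) : Join Z → I :=
  Quotient.lift (fun p : Omega Z => (p.1 i).1) fun _ _ h => (h i).1

/-- The `i`-th weight multiplied by a function of the `i`-th point. -/
def wtMul (i : Fin n) (h : Z i → ℝ) : Join Z → ℝ :=
  Quotient.lift (fun p : Omega Z => ((p.1 i).1 : ℝ) * h (p.1 i).2) fun p q hpq => by
    rw [(hpq i).1]
    by_cases he : (p.1 i).2 = (q.1 i).2
    · rw [he]
    · rw [← (hpq i).1, (hpq i).2 he]; simp

@[simp] theorem wtMul_mk (i : Fin n) (h : Z i → ℝ) (p : Omega Z) :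
    wtMul i h (mk p) = ((p.1 i).1 : ℝ) * h (p.1 i).2 := rfl

variable [∀ i, TopologicalSpace (Z i)]

theorem isQuotientMap_mk : IsQuotientMap (mk : Omega Z → Join Z) := isQuotientMap_quot_mk

theorem continuous_mk : Continuous (mk : Omega Z → Join Z) := isQuotientMap_mk.continuous

theorem continuous_omega_val : Continuous fun p : Omega Z => p.1 := continuous_subtype_val

theorem isInducing_omega_val : IsInducing fun p : Omega Z => p.1 := IsInducing.subtypeVal

theorem continuous_weight (i : Fin n) : Continuous fun p : Omega Z => (p.1 i).1 :=
  continuous_fst.comp ((continuous_apply i).comp continuous_omega_val)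

theorem continuous_coord (i : Fin n) : Continuous fun p : Omega Z => (p.1 i).2 :=
  continuous_snd.comp ((continuous_apply i).comp continuous_omega_val)

theorem continuous_wt (i : Fin n) : Continuous (wt i : Join Z → I) :=
  isQuotientMap_mk.continuous_iff.2 (continuous_weight i)

theorem continuous_wtMul (i : Fin n) {h : Z i → ℝ} (hh : Continuous h) :
    Continuous (wtMul i h : Join Z → ℝ) :=
  isQuotientMap_mk.continuous_iff.2 <|
    (continuous_subtype_val.comp (continuous_weight i)).mul (hh.comp (continuous_coord i))

/-- Where the `i`-th weight does not vanish, the `i`-th point is defined. -/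
def region (i : Fin n) (U : Set (Z i)) : Set (Join Z) :=
  {z | ∃ p : Omega Z, mk p = z ∧ (p.1 i).1 ≠ 0 ∧ (p.1 i).2 ∈ U}

omit [∀ i, TopologicalSpace (Z i)] in
theorem mk_mem_region_iff {i : Fin n} {U : Set (Z i)} {p : Omega Z} :
    mk p ∈ region i U ↔ (p.1 i).1 ≠ 0 ∧ (p.1 i).2 ∈ U := by
  refine ⟨?_, fun h => ⟨p, rfl, h⟩⟩
  rintro ⟨q, hq, h0, hU⟩
  have h := mk_eq_mk_iff.1 hq i
  refine ⟨h.1 ▸ h0, ?_⟩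
  by_cases he : (q.1 i).2 = (p.1 i).2
  · rwa [← he]
  · exact (h0 (h.2 he)).elim

theorem isOpen_region {i : Fin n} {U : Set (Z i)} (hU : IsOpen U) :
    IsOpen (region i U : Set (Join Z)) := by
  rw [← isQuotientMap_mk.isOpen_preimage]
  have : mk ⁻¹' (region i U : Set (Join Z)) =
      {p : Omega Z | (p.1 i).1 ≠ 0} ∩ {p : Omega Z | (p.1 i).2 ∈ U} := by
    ext p; exact mk_mem_region_iff
  rw [this]
  exact (isOpen_ne.preimage (continuous_weight i)).inter (hU.preimage (continuous_coord i))

instance [∀ i, T2Space (Z i)] : T2Space (Join Z) := by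
  refine ⟨fun z w hne => ?_⟩
  obtain ⟨p, rfl⟩ := mk_surjective z
  obtain ⟨q, rfl⟩ := mk_surjective w
  rw [ne_eq, mk_eq_mk_iff, not_forall] at hne
  obtain ⟨i, hi⟩ := hne
  by_cases h1 : (p.1 i).1 = (q.1 i).1
  · simp only [h1, true_and, not_forall] at hi
    obtain ⟨h2, h3⟩ := hi
    obtain ⟨U, V, hU, hV, hpU, hqV, hd⟩ := t2_separation h2
    refine ⟨region i U, region i V, isOpen_region hU, isOpen_region hV,
      mk_mem_region_iff.2 ⟨h1 ▸ h3, hpU⟩, mk_mem_region_iff.2 ⟨h3, hqV⟩, ?_⟩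
    rw [Set.disjoint_left]
    rintro z hz hz'
    obtain ⟨r, rfl⟩ := mk_surjective z
    exact Set.disjoint_left.1 hd (mk_mem_region_iff.1 hz).2 (mk_mem_region_iff.1 hz').2
  · exact separated_by_continuous (continuous_wt i) h1

end FiniteJoin

/-! ### Bordifications by extended geodesics -/

namespace Bordification

/-- The properties of a bordification by extended geodesics which make the compactification of
products work. -/
structure IsCombed (B : Bordification.{u}) : Prop where
  continuous_point : Continuous fun q : B.Total × ℝ≥0 => B.point q.1 q.2
  continuous_incl : Continuous B.incl
  tendsto_incl_point : ∀ z : B.Total,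
    Tendsto (fun q : B.Total × ℝ≥0 => B.incl (B.point q.1 q.2)) (𝓝 z ×ˢ atTop) (𝓝 z)
  dist_point_incl : ∀ x t, dist (B.point (B.incl x) t) B.base = min (t : ℝ) (dist x B.base)
  dist_point_bdry : ∀ (w : B.boundary) (t : ℝ≥0),
    dist (B.point (Sum.inr w : B.carrier ⊕ B.boundary) t) B.base = t
  point_incl : ∀ (x) (t : ℝ≥0), dist x B.base ≤ t → B.point (B.incl x) t = x
  bdry_ext : ∀ v w : B.boundary, (∀ t, B.point (Sum.inr v : B.carrier ⊕ B.boundary) t =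
    B.point (Sum.inr w : B.carrier ⊕ B.boundary) t) → v = w
  isCompact_bdry : IsCompact B.bdry

/-- The function `1 / (1 + |x|)` on `X`, extended by `0` to the boundary. -/
noncomputable def invHeight (B : Bordification.{u}) : B.Total → ℝ :=
  Sum.elim (fun x => (1 + dist x B.base)⁻¹) fun _ => 0

section Single

variable {B : Bordification.{u}}

theorem total_cases (z : B.Total) : (∃ x, z = B.incl x) ∨
    ∃ w : B.boundary, z = (Sum.inr w : B.carrier ⊕ B.boundary) := by
  rcases z with x | w
  · exact .inl ⟨x, rfl⟩
  · exact .inr ⟨w, rfl⟩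

@[simp] theorem invHeight_incl (x : B.carrier) :
    B.invHeight (B.incl x) = (1 + dist x B.base)⁻¹ := rfl

@[simp] theorem invHeight_inr (w : B.boundary) :
    B.invHeight (Sum.inr w : B.carrier ⊕ B.boundary) = 0 := rfl

theorem invHeight_incl_pos (x : B.carrier) : 0 < B.invHeight (B.incl x) := by
  rw [invHeight_incl]; positivity

theorem invHeight_nonneg (z : B.Total) : 0 ≤ B.invHeight z := by
  obtain ⟨x, rfl⟩ | ⟨w, rfl⟩ := total_cases z
  · exact (invHeight_incl_pos x).le
  · exact le_rfl

theorem invHeight_eq_zero_iff {z : B.Total} : B.invHeight z = 0 ↔ z ∈ B.bdry := by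
  obtain ⟨x, rfl⟩ | ⟨w, rfl⟩ := total_cases z
  · refine iff_of_false (invHeight_incl_pos x).ne' ?_
    rintro ⟨w, hw⟩
    exact Sum.inr_ne_inl hw
  · exact iff_of_true rfl ⟨w, rfl⟩

/-- The flow along extended geodesics at times in `[0, ∞]`. -/
noncomputable def flow (B : Bordification.{u}) (q : B.Total × ℝ≥0∞) : B.Total :=
  open Classical in if q.2 = ⊤ then q.1 else B.incl (B.point q.1 q.2.toNNReal)

namespace IsCombed

variable (hB : B.IsCombed)
include hB

theorem point_zero (z : B.Total) : B.point z 0 = B.base := by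
  rw [← dist_eq_zero]
  obtain ⟨x, rfl⟩ | ⟨w, rfl⟩ := total_cases z
  · rw [hB.dist_point_incl]; simp
  · rw [hB.dist_point_bdry]; simp

theorem dist_point_le (z : B.Total) (t : ℝ≥0) : dist (B.point z t) B.base ≤ t := by
  obtain ⟨x, rfl⟩ | ⟨w, rfl⟩ := total_cases z
  · rw [hB.dist_point_incl]; exact min_le_left _ _
  · rw [hB.dist_point_bdry]

theorem continuous_point_right (t : ℝ≥0) : Continuous fun z : B.Total => B.point z t :=
  hB.continuous_point.comp (continuous_id.prodMk continuous_const)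

theorem abs_inv_sub_invHeight_le (z : B.Total) (t : ℝ≥0) :
    |(1 + dist (B.point z t) B.base)⁻¹ - B.invHeight z| ≤ (1 + (t : ℝ))⁻¹ := by
  obtain ⟨x, rfl⟩ | ⟨w, rfl⟩ := total_cases z
  · rw [hB.dist_point_incl, invHeight_incl]
    rcases le_total (dist x B.base) t with h | h
    · rw [min_eq_right h]; simp; positivity
    · rw [min_eq_left h]
      have h1 : (1 + dist x B.base)⁻¹ ≤ (1 + (t : ℝ))⁻¹ := by gcongr
      have h2 : 0 < (1 + dist x B.base)⁻¹ := by positivity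
      rw [abs_le]; constructor <;> linarith
  · rw [hB.dist_point_bdry, invHeight_inr, sub_zero, abs_of_nonneg (by positivity)]

/-- A uniform limit: evaluating the inverse height at time `k` along the extended geodesic is
continuous and errs by at most `1 / (1 + k)`, on the boundary as well. -/
theorem continuous_invHeight : Continuous B.invHeight := by
  have hu : TendstoUniformly (fun (k : ℕ) (z : B.Total) =>
      (1 + dist (B.point z k) B.base)⁻¹) B.invHeight atTop := by
    rw [Metric.tendstoUniformly_iff]
    intro ε hε
    have hl : Tendsto (fun k : ℕ => (1 + (k : ℝ))⁻¹) atTop (𝓝 0) :=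
      tendsto_inv_atTop_zero.comp
        (tendsto_atTop_add_const_left _ _ tendsto_natCast_atTop_atTop)
    filter_upwards [hl.eventually (gt_mem_nhds hε)] with k hk z
    rw [dist_comm, Real.dist_eq]
    exact (hB.abs_inv_sub_invHeight_le z k).trans_lt (by simpa using hk)
  refine hu.continuous (Frequently.of_forall fun k => ?_)
  refine Continuous.inv₀ (continuous_const.add
    ((hB.continuous_point_right k).dist continuous_const)) fun z => ?_
  positivity

theorem isOpen_range_incl : IsOpen (Set.range B.incl) := by
  have : Set.range B.incl = {z | B.invHeight z ≠ 0} := by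
    ext z
    obtain ⟨x, rfl⟩ | ⟨w, rfl⟩ := total_cases z
    · exact iff_of_true ⟨x, rfl⟩ (invHeight_incl_pos x).ne'
    · refine iff_of_false ?_ (fun h => h rfl)
      rintro ⟨x, hx⟩
      exact Sum.inl_ne_inr hx
  rw [this]
  exact isOpen_ne.preimage hB.continuous_invHeight

omit hB in
theorem incl_injective : Function.Injective B.incl := fun _ _ h => Sum.inl_injective h

/-- Evaluation at a fixed time `T > |x|` is continuous on the bordification and inverts the
inclusion near `x`: a nearby `y` has `|y(T)| < T`, so its geodesic has already arrived. -/
theorem isOpenEmbedding_incl : IsOpenEmbedding B.incl := by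
  refine ⟨⟨isInducing_iff_nhds.2 fun x => le_antisymm ?_ ?_, incl_injective⟩,
    hB.isOpen_range_incl⟩
  · exact (hB.continuous_incl.tendsto x).le_comap
  · set T : ℝ≥0 := nndist x B.base + 1 with hT
    have h1 : Tendsto (fun y => B.point (B.incl y) T) (comap B.incl (𝓝 (B.incl x))) (𝓝 x) := by
      have := ((hB.continuous_point_right T).tendsto (B.incl x)).comp
        (tendsto_comap (f := B.incl))
      rwa [hB.point_incl x T (by simp [hT])] at this
    have h2 : ∀ᶠ y in comap B.incl (𝓝 (B.incl x)), B.point (B.incl y) T = y := by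
      have h3 : ∀ᶠ z in 𝓝 (B.incl x), dist (B.point z T) B.base < T := by
        refine (((hB.continuous_point_right T).dist continuous_const).tendsto _).eventually
          (gt_mem_nhds ?_)
        rw [hB.dist_point_incl, hT]
        simp
      filter_upwards [tendsto_comap.eventually h3] with y hy
      refine hB.point_incl y T ?_
      rw [hB.dist_point_incl] at hy
      by_contra! hc
      rw [min_eq_left hc.le] at hy
      exact hy.false
    exact (tendsto_congr' h2).1 h1

/-- The evaluations at finite times are continuous and separate points: two interior points are both
reached at time `|x| + |y|`, and at time `|x| + 1` an interior point has stopped whereas a ray is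
still moving. -/
theorem t2 : T2Space B.Total := by
  refine ⟨fun z w hne => ?_⟩
  by_cases h : ∀ t, B.point z t = B.point w t
  · refine (hne ?_).elim
    obtain ⟨x, rfl⟩ | ⟨v, rfl⟩ := total_cases z <;> obtain ⟨y, rfl⟩ | ⟨w, rfl⟩ := total_cases w
    · have := h (nndist x B.base + nndist y B.base)
      rw [hB.point_incl, hB.point_incl] at this
      · rw [this]
      all_goals simp
    · have := congrArg (dist · B.base) (h (nndist x B.base + 1))
      simp [hB.dist_point_incl, hB.dist_point_bdry] at this
    · have := congrArg (dist · B.base) (h (nndist y B.base + 1))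
      simp [hB.dist_point_incl, hB.dist_point_bdry] at this
    · rw [hB.bdry_ext v w h]
  · push Not at h
    obtain ⟨t, ht⟩ := h
    exact separated_by_continuous (hB.continuous_point_right t) ht

theorem continuous_flow : Continuous B.flow := by
  rw [continuous_iff_continuousAt]
  rintro ⟨z, t⟩
  by_cases ht : t = ⊤
  · subst ht
    intro V hV
    rw [show B.flow (z, ⊤) = z from if_pos rfl] at hV
    have h1 : ∀ᶠ q in 𝓝 z ×ˢ (atTop : Filter ℝ≥0), B.incl (B.point q.1 q.2) ∈ V :=
      hB.tendsto_incl_point z hV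
    obtain ⟨pa, hpa, pb, hpb, h⟩ := eventually_prod_iff.1 h1
    obtain ⟨T, hT⟩ := eventually_atTop.1 hpb
    -- Membership of `q.1` in `V` is added because `q.2` may itself be `⊤`, where the flow is the
    -- identity.
    have h2 : ∀ᶠ q in 𝓝 z ×ˢ 𝓝 (⊤ : ℝ≥0∞), (pa q.1 ∧ q.1 ∈ V) ∧ (T : ℝ≥0∞) < q.2 :=
      (hpa.and hV).prod_mk (lt_mem_nhds ENNReal.coe_lt_top)
    rw [← nhds_prod_eq] at h2
    refine mem_map.2 ?_
    filter_upwards [h2] with q hq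
    by_cases hq2 : q.2 = ⊤
    · simpa [flow, hq2] using hq.1.2
    · simp only [flow, hq2, if_false, Set.mem_preimage]
      refine h hq.1.1 (hT _ ?_)
      exact (ENNReal.le_toNNReal_of_coe_le hq.2.le hq2)
  · have h1 : ContinuousAt (fun q : B.Total × ℝ≥0∞ => B.incl (B.point q.1 q.2.toNNReal))
        (z, t) := by
      refine (hB.continuous_incl.comp hB.continuous_point).continuousAt.comp
        (f := fun q : B.Total × ℝ≥0∞ => (q.1, q.2.toNNReal)) ?_
      exact continuousAt_fst.prodMk ((ENNReal.tendsto_toNNReal ht).comp continuousAt_snd)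
    refine h1.congr ?_
    have : ∀ᶠ q : B.Total × ℝ≥0∞ in 𝓝 (z, t), q.2 ≠ ⊤ :=
      continuousAt_snd.eventually (isOpen_ne.mem_nhds (by exact ht))
    filter_upwards [this] with q hq
    simp [flow, hq]

end IsCombed

end Single

end Bordification

/-! ### Balanced points and the flow on the join -/

namespace Bordification

variable {n : ℕ} {B : Fin n → Bordification.{u}}

/-- The points of the join at which the products of weights and inverse heights agree. -/
def balanced (B : Fin n → Bordification.{u}) : Set (FiniteJoin.Join fun i => (B i).Total) :=
  {z | ∀ i j, FiniteJoin.wtMul i (B i).invHeight z = FiniteJoin.wtMul j (B j).invHeight z}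

/-- The endpoint at time `t` of the extended geodesics to `p`, run with the weights as speeds. -/
def endpoint (p : FiniteJoin.Omega fun i => (B i).Total) (t : ℝ≥0) : Product B :=
  WithLp.toLp 1 fun i => (B i).point (p.1 i).2 (unitInterval.toNNReal (p.1 i).1 * t)

@[simp] theorem endpoint_apply (p : FiniteJoin.Omega fun i => (B i).Total) (t : ℝ≥0) (i : Fin n) :
    endpoint p t i = (B i).point (p.1 i).2 (unitInterval.toNNReal (p.1 i).1 * t) := rfl

theorem mk_mem_balanced {p : FiniteJoin.Omega fun i => (B i).Total} :
    FiniteJoin.mk p ∈ balanced B ↔ ∀ i j, ((p.1 i).1 : ℝ) * (B i).invHeight (p.1 i).2 =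
      ((p.1 j).1 : ℝ) * (B j).invHeight (p.1 j).2 := Iff.rfl

theorem sum_height_pos [NeZero n] (x : Product B) : 0 < ∑ j, height B x j :=
  Finset.sum_pos (fun j _ => height_pos B x j) Finset.univ_nonempty

theorem wtMul_embed [NeZero n] (x : Product B) (i : Fin n) :
    FiniteJoin.wtMul i (B i).invHeight (embed B x) = (∑ j, height B x j)⁻¹ := by
  change weight B x i * (height B x i)⁻¹ = _
  have := (height_pos B x i).ne'
  have := (sum_height_pos x).ne'
  unfold weight
  field_simp

/-- Positivity forces every coordinate to be interior. If `c` is the common value, each weight is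
`c` times the height, and since the weights sum to one they are those prescribed by the embedding.
-/
theorem mem_range_embed_iff [NeZero n] {z : FiniteJoin.Join fun i => (B i).Total} :
    z ∈ Set.range (embed B) ↔
      z ∈ balanced B ∧ ∀ i, 0 < FiniteJoin.wtMul i (B i).invHeight z := by
  constructor
  · rintro ⟨x, rfl⟩
    refine ⟨fun i j => ?_, fun i => ?_⟩
    · rw [wtMul_embed, wtMul_embed]
    · rw [wtMul_embed]; exact inv_pos.2 (sum_height_pos x)
  · obtain ⟨p, rfl⟩ := FiniteJoin.mk_surjective z
    rintro ⟨hb, hp⟩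
    rw [mk_mem_balanced] at hb
    simp only [FiniteJoin.wtMul_mk] at hp
    have hx : ∀ i, ∃ x, (p.1 i).2 = (B i).incl x := fun i => by
      obtain h | ⟨w, hw⟩ := total_cases (p.1 i).2
      · exact h
      · have := hp i
        rw [hw] at this
        simp at this
    choose x hx using hx
    set y : Product B := WithLp.toLp 1 x with hy
    set c := ((p.1 0).1 : ℝ) * (B 0).invHeight (p.1 0).2 with hc
    have hw : ∀ i, ((p.1 i).1 : ℝ) = c * height B y i := fun i => by
      rw [hc, hb 0 i, hx i, invHeight_incl]
      have : (1 + dist (x i) (B i).base) ≠ 0 := by positivity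
      change _ = _ * (1 + dist (x i) (B i).base)
      field_simp
    have hs : c * ∑ i, height B y i = 1 := by
      rw [Finset.mul_sum, ← p.2]
      exact Finset.sum_congr rfl fun i _ => (hw i).symm
    refine ⟨y, ?_⟩
    refine FiniteJoin.mk_eq_mk_iff.2 fun i => ⟨Subtype.ext ?_, fun h => (h (hx i).symm).elim⟩
    change height B y i / ∑ j, height B y j = _
    rw [hw i, div_eq_iff (sum_height_pos y).ne']
    linear_combination (-height B y i) * hs

theorem mem_sub_bdry_iff {z : FiniteJoin.Join fun i => (B i).Total} :
    z ∈ FiniteJoin.sub (fun i => (B i).bdry) ↔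
      ∀ i, FiniteJoin.wtMul i (B i).invHeight z = 0 := by
  constructor
  · rintro ⟨p, rfl, hp⟩ i
    rw [FiniteJoin.wtMul_mk]
    by_cases h : (p.1 i).1 = 0
    · rw [h]; simp
    · rw [invHeight_eq_zero_iff.2 (hp i h), mul_zero]
  · obtain ⟨p, rfl⟩ := FiniteJoin.mk_surjective z
    intro h
    refine ⟨p, rfl, fun i hi => ?_⟩
    rw [← invHeight_eq_zero_iff]
    exact (mul_eq_zero.1 (h i)).resolve_left fun h0 => hi (Subtype.ext h0)

theorem wtMul_nonneg (z : FiniteJoin.Join fun i => (B i).Total) (i : Fin n) :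
    0 ≤ FiniteJoin.wtMul i (B i).invHeight z := by
  obtain ⟨p, rfl⟩ := FiniteJoin.mk_surjective z
  exact mul_nonneg (p.1 i).1.2.1 (invHeight_nonneg _)

theorem balanced_eq [NeZero n] :
    balanced B = Set.range (embed B) ∪ FiniteJoin.sub (fun i => (B i).bdry) := by
  ext z
  rw [Set.mem_union, mem_range_embed_iff, mem_sub_bdry_iff]
  constructor
  · intro h
    rcases (wtMul_nonneg z 0).eq_or_lt with h0 | h0
    · exact .inr fun i => (h i 0).trans h0.symm
    · exact .inl ⟨h, fun i => (h i 0).symm ▸ h0⟩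
  · rintro (h | h)
    · exact h.1
    · exact fun i j => (h i).trans (h j).symm

variable (hB : ∀ i, (B i).IsCombed)
include hB

theorem isClosed_balanced : IsClosed (balanced B) := by
  have : balanced B = ⋂ i, ⋂ j, {z | FiniteJoin.wtMul i (B i).invHeight z =
      FiniteJoin.wtMul j (B j).invHeight z} := by
    ext z; simp [balanced]
  rw [this]
  exact isClosed_iInter fun i => isClosed_iInter fun j =>
    isClosed_eq (FiniteJoin.continuous_wtMul i (hB i).continuous_invHeight)
      (FiniteJoin.continuous_wtMul j (hB j).continuous_invHeight)

theorem height_endpoint_le (p : FiniteJoin.Omega fun i => (B i).Total) (t : ℝ≥0) (i : Fin n) :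
    height B (endpoint p t) i ≤ (p.1 i).1 * t + 1 := by
  have := (hB i).dist_point_le (p.1 i).2 (unitInterval.toNNReal (p.1 i).1 * t)
  rw [NNReal.coe_mul, unitInterval.coe_toNNReal] at this
  change 1 + dist ((B i).point _ _) _ ≤ _
  linarith

/-- The weights of `ι(x₁(t₁t), …, xₙ(tₙt))` converge uniformly to `t₁, …, tₙ` as `t → ∞`. -/
theorem abs_weight_endpoint_sub_le [NeZero n] {p : FiniteJoin.Omega fun i => (B i).Total}
    (hp : FiniteJoin.mk p ∈ balanced B) {t : ℝ≥0} (ht : 0 < t) (i : Fin n) :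
    |weight B (endpoint p t) i - (p.1 i).1| ≤ n / t := by
  have ht' : (0 : ℝ) < t := ht
  have hn : (1 : ℝ) ≤ n := by exact_mod_cast NeZero.one_le
  rw [mk_mem_balanced] at hp
  set c := ((p.1 i).1 : ℝ) * (B i).invHeight (p.1 i).2 with hc
  have hS := sum_height_pos (endpoint p t)
  have hps : ∑ j, ((p.1 j).1 : ℝ) = 1 := p.2
  have hcj : ∀ j (x : (B j).carrier), (p.1 j).2 = (B j).incl x →
      ((p.1 j).1 : ℝ) = c * (1 + dist x (B j).base) := fun j x hx => by
    rw [hc, hp i j, hx, invHeight_incl]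
    have : (1 + dist x (B j).base) ≠ 0 := by positivity
    field_simp
  -- As `tⱼ = c (1 + |xⱼ|)` at interior coordinates, `1 ≤ c t` gives `tⱼ t ≥ 1 + |xⱼ|`: all
  -- geodesics have arrived and the weights agree exactly. Otherwise every height lies between `tⱼ
  -- t` and `tⱼ t + 1`.
  by_cases h1 : 1 ≤ c * t
  · have hc0 : 0 < c := by by_contra! h; nlinarith
    have hH : ∀ j, ((p.1 j).1 : ℝ) = c * height B (endpoint p t) j := fun j => by
      obtain ⟨x, hx⟩ | ⟨w, hw⟩ := total_cases (p.1 j).2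
      · have he : endpoint p t j = x := by
          rw [endpoint_apply, hx]
          refine (hB j).point_incl x _ ?_
          rw [NNReal.coe_mul, unitInterval.coe_toNNReal, hcj j x hx]
          nlinarith [dist_nonneg (x := x) (y := (B j).base)]
        rw [hcj j x hx, height, he]
      · have := hp i j
        rw [← hc, hw, invHeight_inr, mul_zero] at this
        exact (hc0.ne' this).elim
    have hs : c * ∑ j, height B (endpoint p t) j = 1 := by
      rw [Finset.mul_sum, ← hps]
      exact Finset.sum_congr rfl fun j _ => (hH j).symm
    have : weight B (endpoint p t) i = (p.1 i).1 := by
      rw [weight, div_eq_iff hS.ne', hH i]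
      linear_combination (-height B (endpoint p t) i) * hs
    rw [this, sub_self, abs_zero]
    positivity
  · push Not at h1
    have hH : ∀ j, ((p.1 j).1 : ℝ) * t ≤ height B (endpoint p t) j := fun j => by
      have hj0 : (0 : ℝ) ≤ (p.1 j).1 * t := mul_nonneg (p.1 j).1.2.1 t.2
      obtain ⟨x, hx⟩ | ⟨w, hw⟩ := total_cases (p.1 j).2
      · have : ((p.1 j).1 : ℝ) * t ≤ 1 + dist x (B j).base := by
          rw [hcj j x hx]
          nlinarith [dist_nonneg (x := x) (y := (B j).base)]
        rw [height, endpoint_apply, hx, (hB j).dist_point_incl, ← min_add_add_left,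
          NNReal.coe_mul, unitInterval.coe_toNNReal]
        exact le_min (by linarith) this
      · rw [height, endpoint_apply, hw, (hB j).dist_point_bdry, NNReal.coe_mul,
          unitInterval.coe_toNNReal]
        linarith
    have hS1 : (t : ℝ) ≤ ∑ j, height B (endpoint p t) j := by
      calc (t : ℝ) = ∑ j, ((p.1 j).1 : ℝ) * t := by rw [← Finset.sum_mul, hps, one_mul]
        _ ≤ _ := Finset.sum_le_sum fun j _ => hH j
    have hS2 : ∑ j, height B (endpoint p t) j ≤ t + n := by
      calc _ ≤ ∑ j, (((p.1 j).1 : ℝ) * t + 1) :=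
            Finset.sum_le_sum fun j _ => height_endpoint_le hB p t j
        _ = t + n := by rw [Finset.sum_add_distrib, ← Finset.sum_mul, hps]; simp
    have hi0 : (0 : ℝ) ≤ (p.1 i).1 := (p.1 i).1.2.1
    have hi1 : ((p.1 i).1 : ℝ) ≤ 1 := (p.1 i).1.2.2
    have hA := height_endpoint_le hB p t i
    have hA' := hH i
    -- With `S` the sum of heights, `t ≤ S ≤ t + n`, so the numerator `height - tᵢ S` lies between
    -- `-n` and `1`.
    rw [weight, div_sub' hS.ne', abs_div, abs_of_pos hS]
    refine div_le_div₀ (by positivity) ?_ ht' hS1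
    rw [abs_le]
    constructor <;> nlinarith

theorem continuous_embed [NeZero n] : Continuous (embed B) := by
  refine FiniteJoin.continuous_mk.comp (FiniteJoin.isInducing_omega_val.continuous_iff.2 ?_)
  have hc : ∀ i, Continuous fun x : Product B => x i := fun i =>
    PiLp.continuous_apply 1 _ i
  have hh : ∀ i, Continuous fun x : Product B => height B x i := fun i =>
    continuous_const.add ((hc i).dist continuous_const)
  refine continuous_pi fun i => (Continuous.subtype_mk ?_ _).prodMk
    ((hB i).continuous_incl.comp (hc i))
  exact (hh i).div (continuous_finsetSum _ fun j _ => hh j) fun x => (sum_height_pos x).ne'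

theorem continuous_endpoint :
    Continuous fun q : (FiniteJoin.Omega fun i => (B i).Total) × ℝ≥0 => endpoint q.1 q.2 := by
  refine (PiLp.continuous_toLp 1 _).comp (continuous_pi fun i => ?_)
  have hw : Continuous fun q : (FiniteJoin.Omega fun i => (B i).Total) × ℝ≥0 =>
      unitInterval.toNNReal (q.1.1 i).1 * q.2 :=
    (unitInterval.toNNReal_continuous.comp
      ((FiniteJoin.continuous_weight i).comp continuous_fst)).mul continuous_snd
  exact (hB i).continuous_point.comp
    (((FiniteJoin.continuous_coord i).comp continuous_fst).prodMk hw)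

omit hB in
/-- The contraction on representatives. -/
noncomputable def preContraction [NeZero n] (B : Fin n → Bordification.{u})
    (q : (FiniteJoin.Omega fun i => (B i).Total) × ℝ≥0∞) : FiniteJoin.Join fun i => (B i).Total :=
  open Classical in
  if q.2 = ⊤ then FiniteJoin.mk q.1 else embed B (endpoint q.1 q.2.toNNReal)

omit hB in
/-- A representative of the contraction, whose points are moved by the flows. -/
noncomputable def contractionRep [NeZero n] (B : Fin n → Bordification.{u})
    (q : (FiniteJoin.Omega fun i => (B i).Total) × ℝ≥0∞) : FiniteJoin.Omega fun i => (B i).Total :=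
  open Classical in
  ⟨fun i => (if q.2 = ⊤ then (q.1.1 i).1 else
      ⟨weight B (endpoint q.1 q.2.toNNReal) i, weight_mem B _ i⟩,
    (B i).flow ((q.1.1 i).2, unitInterval.toNNReal (q.1.1 i).1 * q.2)), by
    by_cases h : q.2 = ⊤
    · simpa only [h, if_true] using q.1.2
    · simpa only [h, if_false] using sum_weight B _⟩

omit hB in
-- At time `⊤` the convention `0 * ⊤ = 0` makes the flow stop coordinates of weight zero at time
-- `0`. The two representatives can differ only there.
theorem mk_contractionRep [NeZero n] (q : (FiniteJoin.Omega fun i => (B i).Total) × ℝ≥0∞) :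
    FiniteJoin.mk (contractionRep B q) = preContraction B q := by
  obtain ⟨p, t⟩ := q
  by_cases h : t = ⊤
  · subst h
    refine (FiniteJoin.mk_eq_mk_iff.2 fun i => ?_).trans (if_pos rfl).symm
    have hw : ((contractionRep B (p, ⊤)).1 i).1 = (p.1 i).1 := by
      simp [contractionRep]
    refine ⟨hw, fun hne => ?_⟩
    by_contra h0
    refine hne ?_
    have h0' : (p.1 i).1 ≠ 0 := fun h => h0 (hw.trans h)
    have h1 : (unitInterval.toNNReal (p.1 i).1 : ℝ≥0∞) ≠ 0 := by
      rw [Ne, ENNReal.coe_eq_zero]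
      exact fun h => h0' (Subtype.ext (congrArg NNReal.toReal h))
    exact if_pos (ENNReal.mul_top h1)
  · refine (FiniteJoin.mk_eq_mk_iff.2 fun i => ?_).trans (if_neg h).symm
    refine ⟨if_neg h, fun hne => (hne ?_).elim⟩
    change (B i).flow _ = _
    rw [flow, if_neg (ENNReal.mul_ne_top ENNReal.coe_ne_top h)]
    simp only [ENNReal.toNNReal_mul, ENNReal.toNNReal_coe]
    rfl

theorem continuousOn_preContraction [NeZero n] :
    ContinuousOn (preContraction B) {q | FiniteJoin.mk q.1 ∈ balanced B} := by
  rintro ⟨p, t⟩ hp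
  change FiniteJoin.mk p ∈ balanced B at hp
  by_cases ht : t = ⊤
  · subst ht
    -- Where a weight tends to `0`, weight times time is indeterminate. Along an ultrafilter it
    -- nevertheless converges to some `s i`, since `[0, ∞]` is compact.
    rw [ContinuousWithinAt, tendsto_iff_ultrafilter]
    intro U hU
    have hU1 : (U : Filter _) ≤ 𝓝 (p, (⊤ : ℝ≥0∞)) := hU.trans nhdsWithin_le_nhds
    have hUp : Tendsto Prod.fst (U : Filter ((FiniteJoin.Omega fun i => (B i).Total) × ℝ≥0∞))
        (𝓝 p) := (continuous_fst.tendsto (p, (⊤ : ℝ≥0∞))).mono_left hU1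
    have hUt : Tendsto Prod.snd (U : Filter ((FiniteJoin.Omega fun i => (B i).Total) × ℝ≥0∞))
        (𝓝 ⊤) := (continuous_snd.tendsto (p, (⊤ : ℝ≥0∞))).mono_left hU1
    have hUb : ∀ᶠ q in (U : Filter ((FiniteJoin.Omega fun i => (B i).Total) × ℝ≥0∞)),
        FiniteJoin.mk q.1 ∈ balanced B := hU eventually_mem_nhdsWithin
    have hw : ∀ i, Tendsto (fun q : (FiniteJoin.Omega fun i => (B i).Total) × ℝ≥0∞ =>
        (q.1.1 i).1) U (𝓝 (p.1 i).1) := fun i =>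
      ((FiniteJoin.continuous_weight i).tendsto p).comp hUp
    have hx : ∀ i, Tendsto (fun q : (FiniteJoin.Omega fun i => (B i).Total) × ℝ≥0∞ =>
        (q.1.1 i).2) U (𝓝 (p.1 i).2) := fun i =>
      ((FiniteJoin.continuous_coord i).tendsto p).comp hUp
    set τ : Fin n → (FiniteJoin.Omega fun i => (B i).Total) × ℝ≥0∞ → ℝ≥0∞ := fun i q =>
      unitInterval.toNNReal (q.1.1 i).1 * q.2 with hτ
    have hs : ∀ i, ∃ s, Tendsto (τ i) U (𝓝 s) := fun i => by
      obtain ⟨s, -, h⟩ := isCompact_univ.ultrafilter_le_nhds' (U.map (τ i)) univ_mem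
      exact ⟨s, h⟩
    choose s hs using hs
    have hst : ∀ i, (p.1 i).1 ≠ 0 → s i = ⊤ := fun i hi => by
      have h1 : Tendsto (fun q : (FiniteJoin.Omega fun i => (B i).Total) × ℝ≥0∞ =>
          (unitInterval.toNNReal (q.1.1 i).1 : ℝ≥0∞)) U
          (𝓝 (unitInterval.toNNReal (p.1 i).1 : ℝ≥0∞)) :=
        ENNReal.tendsto_coe.2 ((unitInterval.toNNReal_continuous.tendsto _).comp (hw i))
      have h0 : (unitInterval.toNNReal (p.1 i).1 : ℝ≥0∞) ≠ 0 := by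
        rw [Ne, ENNReal.coe_eq_zero]
        exact fun h => hi (Subtype.ext (congrArg NNReal.toReal h))
      have h2 := ENNReal.Tendsto.mul h1 (.inl h0) hUt (.inr ENNReal.coe_ne_top)
      rw [ENNReal.mul_top h0] at h2
      exact tendsto_nhds_unique (hs i) h2
    -- `L` is the limit of the representatives. It differs from `p` at most in coordinates of weight
    -- zero, because `s i = ⊤` at all others.
    set L : FiniteJoin.Omega fun i => (B i).Total :=
      ⟨fun i => ((p.1 i).1, (B i).flow ((p.1 i).2, s i)), p.2⟩ with hL
    have hLp : FiniteJoin.mk L = preContraction B (p, ⊤) := by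
      rw [show preContraction B (p, ⊤) = FiniteJoin.mk p from if_pos rfl]
      refine FiniteJoin.mk_eq_mk_iff.2 fun i => ⟨rfl, fun hne => ?_⟩
      by_contra h0
      refine hne ?_
      change (B i).flow _ = _
      rw [hst i h0]
      exact if_pos rfl
    rw [← hLp]
    have hlim : Tendsto (contractionRep B) U (𝓝 L) := by
      rw [FiniteJoin.isInducing_omega_val.tendsto_nhds_iff, tendsto_pi_nhds]
      intro i
      refine Tendsto.prodMk_nhds ?_ ?_
      · rw [tendsto_subtype_rng]
        have hd : Tendsto (fun q : (FiniteJoin.Omega fun i => (B i).Total) × ℝ≥0∞ =>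
            (n : ℝ) * (q.2⁻¹).toReal) U (𝓝 0) := by
          have h1 : Tendsto (fun q : (FiniteJoin.Omega fun i => (B i).Total) × ℝ≥0∞ =>
            (q.2⁻¹).toReal) U (𝓝 0) := by
            have := (ENNReal.tendsto_toReal (a := (⊤ : ℝ≥0∞)⁻¹) (by simp)).comp
              ((continuous_inv.tendsto _).comp hUt)
            rwa [ENNReal.inv_top, ENNReal.toReal_zero] at this
          simpa using h1.const_mul (n : ℝ)
        have hv : Tendsto (fun q : (FiniteJoin.Omega fun i => (B i).Total) × ℝ≥0∞ =>
            ((q.1.1 i).1 : ℝ)) U (𝓝 ((p.1 i).1 : ℝ)) :=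
          (continuous_subtype_val.tendsto _).comp (hw i)
        refine hv.congr_dist (squeeze_zero' (.of_forall fun _ => dist_nonneg) ?_ hd)
        filter_upwards [hUb, hUt.eventually (lt_mem_nhds ENNReal.zero_lt_top)] with q hq hq0
        by_cases hqt : q.2 = ⊤
        · simp [hqt]
        · have := abs_weight_endpoint_sub_le hB hq (ENNReal.toNNReal_pos hq0.ne' hqt) i
          rw [dist_comm, Real.dist_eq]
          simp only [hqt, if_false]
          refine this.trans_eq ?_
          rw [ENNReal.toReal_inv, div_eq_mul_inv]
          rfl
      · exact ((hB i).continuous_flow.tendsto _).comp ((hx i).prodMk_nhds (hs i))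
    exact ((FiniteJoin.continuous_mk.tendsto L).comp hlim).congr mk_contractionRep
  · have h1 : ContinuousAt (fun q : (FiniteJoin.Omega fun i => (B i).Total) × ℝ≥0∞ =>
        embed B (endpoint q.1 q.2.toNNReal)) (p, t) :=
      ((continuous_embed hB).comp (continuous_endpoint hB)).continuousAt.comp
        (f := fun q : (FiniteJoin.Omega fun i => (B i).Total) × ℝ≥0∞ => (q.1, q.2.toNNReal))
        (continuousAt_fst.prodMk ((ENNReal.tendsto_toNNReal ht).comp continuousAt_snd))
    refine (h1.congr ?_).continuousWithinAt
    have : ∀ᶠ q : (FiniteJoin.Omega fun i => (B i).Total) × ℝ≥0∞ in 𝓝 (p, t), q.2 ≠ ⊤ :=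
      continuousAt_snd.eventually (isOpen_ne.mem_nhds (by exact ht))
    filter_upwards [this] with q hq
    exact (if_neg hq).symm

end Bordification

/-! ### The compactification and its contraction -/

namespace Bordification

variable {n : ℕ} [NeZero n] {B : Fin n → Bordification.{u}}

theorem range_embed_subset_balanced : Set.range (embed B) ⊆ balanced B := by
  rw [balanced_eq]; exact Set.subset_union_left

omit [NeZero n] in
theorem endpoint_zero (hB : ∀ i, (B i).IsCombed) (p : FiniteJoin.Omega fun i => (B i).Total) :
    endpoint p 0 = WithLp.toLp 1 fun i => (B i).base := by
  unfold endpoint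
  congr 1
  funext i
  rw [mul_zero]
  exact (hB i).point_zero _

omit [NeZero n] in
-- A coordinate of weight zero has speed zero and stays at the base point, whichever point
-- represents it.
theorem endpoint_congr (hB : ∀ i, (B i).IsCombed) {p q : FiniteJoin.Omega fun i => (B i).Total}
    (h : FiniteJoin.mk p = FiniteJoin.mk q) (t : ℝ≥0) : endpoint p t = endpoint q t := by
  unfold endpoint
  congr 1
  funext i
  obtain ⟨h1, h2⟩ := FiniteJoin.mk_eq_mk_iff.1 h i
  by_cases he : (p.1 i).2 = (q.1 i).2
  · rw [h1, he]
  · rw [← h1, h2 he, unitInterval.toNNReal_zero, zero_mul, (hB i).point_zero, (hB i).point_zero]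

theorem prodClosure_eq_balanced (hB : ∀ i, (B i).IsCombed) : prodClosure B = balanced B := by
  refine Set.Subset.antisymm
    (closure_minimal range_embed_subset_balanced (isClosed_balanced hB)) fun z hz => ?_
  obtain ⟨p, rfl⟩ := FiniteJoin.mk_surjective z
  have h1 : Tendsto (fun k : ℕ => (p, (k : ℝ≥0∞))) atTop
      (𝓝[{q | FiniteJoin.mk q.1 ∈ balanced B}] (p, ⊤)) := by
    refine tendsto_nhdsWithin_iff.2 ⟨?_, .of_forall fun _ => hz⟩
    exact tendsto_const_nhds.prodMk_nhds ENNReal.tendsto_nat_nhds_top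
  have h2 := (continuousOn_preContraction hB (p, ⊤) hz).tendsto.comp h1
  rw [show preContraction B (p, ⊤) = FiniteJoin.mk p from if_pos rfl] at h2
  refine mem_closure_of_tendsto h2 (.of_forall fun k => ?_)
  rw [Function.comp_apply, preContraction, if_neg (ENNReal.natCast_ne_top k)]
  exact Set.mem_range_self _

omit [NeZero n] in
theorem t2Space_join (hB : ∀ i, (B i).IsCombed) :
    T2Space (FiniteJoin.Join fun i => (B i).Total) :=
  have := fun i => (hB i).t2
  inferInstance

theorem embed_injective : Function.Injective (embed B) := by
  intro x y h
  ext i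
  have hi := FiniteJoin.mk_eq_mk_iff.1 h i
  by_contra hne
  have h0 : weight B x i = 0 :=
    congrArg Subtype.val (hi.2 fun he => hne (Sum.inl_injective he))
  exact (div_pos (height_pos B x i) (sum_height_pos x)).ne' h0

/-- Weights never vanish on the image, so the open regions over the `i`-th factor detect the `i`-th
coordinate. -/
theorem isEmbedding_embed (hB : ∀ i, (B i).IsCombed) : IsEmbedding (embed B) := by
  refine ⟨isInducing_iff_nhds.2 fun x => le_antisymm
    ((continuous_embed hB).tendsto x).le_comap ?_, embed_injective⟩
  have h1 : Tendsto id (comap (embed B) (𝓝 (embed B x))) (𝓝 x) := by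
    have h2 : 𝓝 x = comap (fun y : Product B => fun i => y i) (𝓝 fun i => x i) :=
      (PiLp.homeomorph 1 fun i => (B i).carrier).isInducing.nhds_eq_comap x
    rw [h2, tendsto_comap_iff, tendsto_pi_nhds]
    intro i
    refine (hB i).isOpenEmbedding_incl.isInducing.tendsto_nhds_iff.2 fun V hV => ?_
    obtain ⟨U, hUV, hU, hxU⟩ := mem_nhds_iff.1 hV
    have h3 : ∀ y : Product B, embed B y ∈ FiniteJoin.region i U ↔ (B i).incl (y i) ∈ U :=
      fun y => FiniteJoin.mk_mem_region_iff.trans (and_iff_right fun h0 =>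
        (div_pos (height_pos B y i) (sum_height_pos y)).ne' (congrArg Subtype.val h0))
    have h4 : embed B ⁻¹' FiniteJoin.region i U ∈ comap (embed B) (𝓝 (embed B x)) :=
      preimage_mem_comap ((FiniteJoin.isOpen_region hU).mem_nhds ((h3 x).2 hxU))
    exact mem_map.2 (mem_of_superset h4 fun y hy => hUV ((h3 y).1 hy))
  exact h1

theorem isOpenEmbedding_embedClosure (hB : ∀ i, (B i).IsCombed) :
    IsOpenEmbedding (embedClosure B) := by
  refine ⟨IsEmbedding.of_comp ((continuous_embed hB).subtype_mk _) continuous_subtype_val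
    (isEmbedding_embed hB), ?_⟩
  have : Set.range (embedClosure B) = Subtype.val ⁻¹'
      {z | 0 < FiniteJoin.wtMul 0 (B 0).invHeight z} := by
    ext ⟨z, hz⟩
    have hz' : z ∈ balanced B := prodClosure_eq_balanced hB ▸ hz
    have h1 : (⟨z, hz⟩ : prodClosure B) ∈ Set.range (embedClosure B) ↔
        z ∈ Set.range (embed B) := by
      simp [Set.mem_range, embedClosure, Subtype.ext_iff]
    rw [h1, mem_range_embed_iff, and_iff_right hz']
    exact ⟨fun h => h 0, fun h i => (hz' i 0).symm ▸ h⟩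
  rw [this]
  exact (isOpen_lt continuous_const
    (FiniteJoin.continuous_wtMul 0 (hB 0).continuous_invHeight)).preimage continuous_subtype_val

/-- On a bounded set the heights have bounded sum, so the weighted inverse heights have a positive
lower bound. This bound passes to the closure and keeps limit points inside the image. -/
theorem isClosed_image_embed (hB : ∀ i, (B i).IsCombed) {A : Set (Product B)}
    (hA : IsClosed A) (hb : Bornology.IsBounded A) : IsClosed (embed B '' A) := by
  obtain ⟨R, hR⟩ := hb.subset_closedBall (WithLp.toLp 1 fun i => (B i).base)
  have hsum : ∀ x ∈ A, ∑ i, height B x i ≤ n * (1 + R) := fun x hx => by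
    have h1 : ∀ i, height B x i ≤ 1 + R := fun i => by
      have h2 := (PiLp.lipschitzWith_ofLp 1 fun i => (B i).carrier).dist_le_mul x
        (WithLp.toLp 1 fun i => (B i).base)
      have h3 := dist_le_pi_dist x.ofLp (fun i => (B i).base) i
      have h4 := Metric.mem_closedBall.1 (hR hx)
      simp only [NNReal.coe_one, one_mul] at h2
      change 1 + dist (x.ofLp i) _ ≤ _
      linarith
    calc _ ≤ ∑ _i : Fin n, (1 + R) := Finset.sum_le_sum fun i _ => h1 i
      _ = _ := by rw [Finset.sum_const, Finset.card_univ, Fintype.card_fin, nsmul_eq_mul]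
  rw [← closure_subset_iff_isClosed]
  intro z hz
  -- A point of `A` is needed to know that `n * (1 + R)` is positive, as nothing is known about the
  -- sign of `R`.
  obtain ⟨x₀, hx₀⟩ : A.Nonempty := (Set.image_nonempty.1 (closure_nonempty_iff.1 ⟨z, hz⟩))
  have hpos : 0 < n * (1 + R) := (sum_height_pos x₀).trans_le (hsum x₀ hx₀)
  have h1 : ∀ i, (n * (1 + R))⁻¹ ≤ FiniteJoin.wtMul i (B i).invHeight z := fun i => by
    have hc : IsClosed {z : FiniteJoin.Join fun i => (B i).Total | (n * (1 + R))⁻¹ ≤ FiniteJoin.wtMul i (B i).invHeight z} :=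
      isClosed_le continuous_const (FiniteJoin.continuous_wtMul i (hB i).continuous_invHeight)
    refine closure_minimal ?_ hc hz
    rintro _ ⟨x, hx, rfl⟩
    rw [Set.mem_ofPred_eq, wtMul_embed]
    exact inv_anti₀ (sum_height_pos x) (hsum x hx)
  have h2 : z ∈ balanced B := closure_minimal
    ((Set.image_subset_range _ _).trans range_embed_subset_balanced) (isClosed_balanced hB) hz
  obtain ⟨x, rfl⟩ := mem_range_embed_iff.2 ⟨h2, fun i => (inv_pos.2 hpos).trans_le (h1 i)⟩
  refine ⟨x, ?_, rfl⟩
  rwa [← hA.closure_eq, (isEmbedding_embed hB).closure_eq_preimage_closure_image]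

omit [NeZero n] in
-- Coordinates of weight zero may be replaced by the base point, so the set is the image of a
-- compact set of representatives. Adjoining the base point also covers factors with empty boundary.
theorem isCompact_sub_bdry (hB : ∀ i, (B i).IsCombed) :
    IsCompact (FiniteJoin.sub (fun i => (B i).bdry)) := by
  set K : Set (∀ i, I × (B i).Total) :=
    Set.univ.pi fun i => Set.univ ×ˢ ((B i).bdry ∪ {(B i).incl (B i).base}) with hK
  have hKc : IsCompact K := isCompact_univ_pi fun i =>
    isCompact_univ.prod ((hB i).isCompact_bdry.union isCompact_singleton)
  have hsc : IsClosed {p : ∀ i, I × (B i).Total | ∑ i, ((p i).1 : ℝ) = 1} :=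
    isClosed_eq (continuous_finsetSum _ fun i _ =>
      continuous_subtype_val.comp (continuous_fst.comp (continuous_apply i))) continuous_const
  have hL : IsCompact {p : FiniteJoin.Omega fun i => (B i).Total | p.1 ∈ K} :=
    (hsc.isClosedEmbedding_subtypeVal).isCompact_preimage hKc
  have hc : IsClosed {p : FiniteJoin.Omega fun i => (B i).Total |
      ∀ i, FiniteJoin.wtMul i (B i).invHeight (FiniteJoin.mk p) = 0} := by
    simp only [Set.ofPred_forall]
    exact isClosed_iInter fun i => isClosed_eq
      ((FiniteJoin.continuous_wtMul i (hB i).continuous_invHeight).comp FiniteJoin.continuous_mk)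
      continuous_const
  convert (hL.inter_right hc).image FiniteJoin.continuous_mk using 1
  refine Set.Subset.antisymm (fun z hz => ?_) ?_
  · have hz0 := mem_sub_bdry_iff.1 hz
    obtain ⟨p, rfl, hp⟩ := hz
    classical
    let y : ∀ i, (B i).Total := fun i =>
      if (p.1 i).2 ∈ (B i).bdry then (p.1 i).2 else (B i).incl (B i).base
    have hy : FiniteJoin.mk (⟨fun i => ((p.1 i).1, y i), p.2⟩ :
        FiniteJoin.Omega fun i => (B i).Total) = FiniteJoin.mk p := by
      refine FiniteJoin.mk_eq_mk_iff.2 fun i => ⟨rfl, fun hne => ?_⟩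
      by_contra h0
      exact hne (if_pos (hp i h0))
    refine ⟨_, ⟨fun i _ => ⟨trivial, ?_⟩, ?_⟩, hy⟩
    · change y i ∈ _
      by_cases h : (p.1 i).2 ∈ (B i).bdry
      · exact .inl (by simpa only [y, if_pos h] using h)
      · exact .inr (if_neg h)
    · change ∀ i, _
      rwa [hy]
  · rintro _ ⟨p, ⟨-, hp⟩, rfl⟩
    exact mem_sub_bdry_iff.2 hp

theorem isCompactificationAtInfinity_embedClosure (hB : ∀ i, (B i).IsCombed) :
    IsCompactificationAtInfinity (embedClosure B) where
  t2 := have := t2Space_join hB; inferInstance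
  isOpenEmbedding := isOpenEmbedding_embedClosure hB
  isClosed_image A hA hb := by
    have : embedClosure B '' A = Subtype.val ⁻¹' (embed B '' A) := by
      ext z
      simp [embedClosure, Subtype.ext_iff]
    rw [this]
    exact (isClosed_image_embed hB hA hb).preimage continuous_subtype_val
  isCompact_compl := by
    have hcl : IsClosed (prodClosure B) := isClosed_closure
    have : (Set.range (embedClosure B))ᶜ =
        Subtype.val ⁻¹' (FiniteJoin.sub (fun i => (B i).bdry)) := by
      ext ⟨z, hz⟩
      have hz' : z ∈ balanced B := prodClosure_eq_balanced hB ▸ hz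
      have h1 : (⟨z, hz⟩ : prodClosure B) ∈ Set.range (embedClosure B) ↔
          z ∈ Set.range (embed B) := by
        simp [Set.mem_range, embedClosure, Subtype.ext_iff]
      rw [Set.mem_compl_iff, h1, mem_range_embed_iff, and_iff_right hz', Set.mem_preimage,
        mem_sub_bdry_iff]
      refine ⟨fun h i => ?_, fun h h' => (h' 0).ne' (h 0)⟩
      by_contra h0
      have := (wtMul_nonneg z i).lt_of_ne' h0
      exact h fun j => hz' i j ▸ this
    rw [this]
    exact hcl.isClosedEmbedding_subtypeVal.isCompact_preimage (isCompact_sub_bdry hB)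

/-- The contraction of `prodClosure B`. -/
noncomputable def contraction (B : Fin n → Bordification.{u}) (q : prodClosure B × ℝ≥0∞) :
    prodClosure B :=
  open Classical in
  if q.2 = ⊤ then q.1
  else embedClosure B (endpoint (FiniteJoin.mk_surjective q.1.1).choose q.2.toNNReal)

theorem contraction_top (z : prodClosure B) : contraction B (z, ⊤) = z := if_pos rfl

theorem contraction_coe (hB : ∀ i, (B i).IsCombed) (p : FiniteJoin.Omega fun i => (B i).Total)
    (hp : FiniteJoin.mk p ∈ prodClosure B) (t : ℝ≥0) :
    contraction B (⟨FiniteJoin.mk p, hp⟩, t) = embedClosure B (endpoint p t) := by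
  rw [contraction, if_neg ENNReal.coe_ne_top]
  exact congrArg _ (endpoint_congr hB (FiniteJoin.mk_surjective (FiniteJoin.mk p)).choose_spec t)

theorem contraction_zero (hB : ∀ i, (B i).IsCombed) (z : prodClosure B) :
    contraction B (z, 0) = embedClosure B (WithLp.toLp 1 fun i => (B i).base) := by
  obtain ⟨z, hz⟩ := z
  obtain ⟨p, rfl⟩ := FiniteJoin.mk_surjective z
  rw [← endpoint_zero hB p]
  exact contraction_coe hB p hz 0

theorem continuous_contraction (hB : ∀ i, (B i).IsCombed) : Continuous (contraction B) := by
  have hq := FiniteJoin.isQuotientMap_mk.restrictPreimage_isClosed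
    (isClosed_closure : IsClosed (prodClosure B))
  refine hq.continuous_lift_prod_left (IsInducing.subtypeVal.continuous_iff.2 ?_)
  have h1 : Continuous fun q : (FiniteJoin.mk ⁻¹' prodClosure B :
      Set (FiniteJoin.Omega fun i => (B i).Total)) × ℝ≥0∞ => preContraction B (q.1.1, q.2) := by
    refine (continuousOn_preContraction hB).comp_continuous
      (f := fun q : (FiniteJoin.mk ⁻¹' prodClosure B :
        Set (FiniteJoin.Omega fun i => (B i).Total)) × ℝ≥0∞ => (q.1.1, q.2))
      ((continuous_subtype_val.comp continuous_fst).prodMk continuous_snd) fun q => ?_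
    exact (prodClosure_eq_balanced hB).subset q.1.2
  refine h1.congr ?_
  rintro ⟨⟨p, hp⟩, t⟩
  rcases eq_or_ne t ⊤ with rfl | ht
  · rw [preContraction, if_pos rfl]
    exact congrArg Subtype.val (contraction_top (B := B) ⟨FiniteJoin.mk p, hp⟩).symm
  · lift t to ℝ≥0 using ht
    rw [preContraction, if_neg ENNReal.coe_ne_top]
    exact congrArg Subtype.val (contraction_coe hB p hp t).symm

theorem contractibleSpace_prodClosure (hB : ∀ i, (B i).IsCombed) :
    ContractibleSpace (prodClosure B) := by
  set x₀ := embedClosure B (WithLp.toLp 1 fun i => (B i).base) with hx₀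
  rw [contractible_iff_id_nullhomotopic]
  refine ⟨x₀, ContinuousMap.Homotopic.symm ⟨⟨⟨fun q => contraction B
    (q.2, ENNReal.orderIsoUnitIntervalBirational.symm q.1), ?_⟩, fun z => ?_, fun z => ?_⟩⟩⟩
  · exact (continuous_contraction hB).comp (continuous_snd.prodMk
      (ENNReal.orderIsoUnitIntervalBirational.symm.continuous.comp continuous_fst))
  · have : ENNReal.orderIsoUnitIntervalBirational.symm (0 : I) = 0 :=
      ENNReal.orderIsoUnitIntervalBirational.symm.map_bot
    change contraction B (z, ENNReal.orderIsoUnitIntervalBirational.symm (0 : I)) = x₀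
    rw [this]
    exact contraction_zero hB z
  · have : ENNReal.orderIsoUnitIntervalBirational.symm (1 : I) = ⊤ :=
      ENNReal.orderIsoUnitIntervalBirational.symm.map_top
    change contraction B (z, ENNReal.orderIsoUnitIntervalBirational.symm (1 : I)) = z
    rw [this]
    exact contraction_top z

end Bordification

/-! ### Proper Busemann spaces -/

namespace IsBusemannSpace

variable {X : Type u} [MetricSpace X] (hX : IsBusemannSpace X)
include hX

/-- Convexity along the diagonal of the rectangle from `(0, 0)` to `(a, b)`, with the distance
vanishing at the first corner. -/
theorem dist_le_mul_dist {γ γ' : ℝ → X} {a b : ℝ} (hγ : IsGeodesicOn γ 0 a)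
    (hγ' : IsGeodesicOn γ' 0 b) (h0 : γ 0 = γ' 0) (ha : 0 ≤ a) (hb : 0 ≤ b) {l : ℝ} (hl0 : 0 ≤ l)
    (hl1 : l ≤ 1) : dist (γ (l * a)) (γ' (l * b)) ≤ l * dist (γ a) (γ' b) := by
  have h := (hX.convex γ γ' 0 a 0 b hγ hγ').2 (x := (0, 0)) (y := (a, b))
    ⟨Set.left_mem_Icc.2 ha, Set.left_mem_Icc.2 hb⟩
    ⟨Set.right_mem_Icc.2 ha, Set.right_mem_Icc.2 hb⟩ (sub_nonneg.2 hl1) hl0 (by ring)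
  simpa [h0] using h

theorem eqOn_of_isGeodesicOn {γ γ' : ℝ → X} {a : ℝ} (hγ : IsGeodesicOn γ 0 a)
    (hγ' : IsGeodesicOn γ' 0 a) (h0 : γ 0 = γ' 0) (ha : γ a = γ' a) {t : ℝ}
    (ht : t ∈ Set.Icc 0 a) : γ t = γ' t := by
  have ha0 : 0 ≤ a := ht.1.trans ht.2
  have h := hX.dist_le_mul_dist hγ hγ' h0 ha0 ha0 (div_nonneg ht.1 ha0)
    (div_le_one_of_le₀ ht.2 ha0)
  rw [ha, dist_self, mul_zero] at h
  have hd : t / a * a = t := by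
    rcases ha0.eq_or_lt with h0 | h0
    · rw [← h0, mul_zero]; exact le_antisymm ht.1 (h0 ▸ ht.2)
    · exact div_mul_cancel₀ _ h0.ne'
  rw [hd] at h
  exact dist_le_zero.1 h

theorem exists_extGeodesic_eq (o x : X) : ∃ γ : ℝ → X, IsGeodesicOn γ 0 (dist o x) ∧ γ 0 = o ∧
    γ (dist o x) = x ∧ ∀ s, hX.extGeodesic o x s = γ (min s (dist o x)) :=
  ⟨_, (hX.geodesic o x).choose_spec.1, (hX.geodesic o x).choose_spec.2.1,
    (hX.geodesic o x).choose_spec.2.2, fun _ => rfl⟩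

theorem extGeodesic_of_isGeodesicOn {γ : ℝ → X} {a : ℝ} (hγ : IsGeodesicOn γ 0 a) (ha : 0 ≤ a)
    (s : ℝ≥0) : hX.extGeodesic (γ 0) (γ a) s = γ (min s a) := by
  have hd : dist (γ 0) (γ a) = a := by
    rw [hγ 0 (Set.left_mem_Icc.2 ha) a (Set.right_mem_Icc.2 ha), zero_sub, abs_neg, abs_of_nonneg ha]
  obtain ⟨γ', h1, h2, h3, h4⟩ := hX.exists_extGeodesic_eq (γ 0) (γ a)
  rw [h4]
  rw [hd] at h1 h3 ⊢
  exact hX.eqOn_of_isGeodesicOn h1 hγ h2 h3 ⟨le_min s.2 ha, min_le_right _ _⟩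

theorem dist_extGeodesic_base (o x : X) (t : ℝ≥0) :
    dist (hX.extGeodesic o x t) o = min (t : ℝ) (dist x o) := by
  obtain ⟨γ, h1, h2, -, h4⟩ := hX.exists_extGeodesic_eq o x
  have h0 : 0 ≤ min (t : ℝ) (dist o x) := le_min t.2 dist_nonneg
  rw [h4]
  nth_rewrite 2 [← h2]
  rw [h1 _ ⟨h0, min_le_right _ _⟩ _ (Set.left_mem_Icc.2 dist_nonneg), sub_zero, abs_of_nonneg h0,
    dist_comm o]

theorem extGeodesic_eq_self {o x : X} {t : ℝ≥0} (ht : dist x o ≤ t) :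
    hX.extGeodesic o x t = x := by
  obtain ⟨γ, -, -, h3, h4⟩ := hX.exists_extGeodesic_eq o x
  rw [h4, min_eq_right (by rwa [dist_comm]), h3]

/-- An initial segment of a geodesic or ray is the unique geodesic to its endpoint. Hence `z(T)` and
`z` have the same path up to time `T`, which gives convergence of `z(T)` to `z`. -/
theorem extGeodesic_toPath {o : X} (z : X ⊕ VisualBoundary o) (T s : ℝ≥0) :
    hX.extGeodesic o (hX.toPath o z T) s = hX.toPath o z (min s T) := by
  rcases z with x | c
  · change hX.extGeodesic o (hX.extGeodesic o x T) s = hX.extGeodesic o x (min s T)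
    obtain ⟨γ, h1, h2, h3, h4⟩ := hX.exists_extGeodesic_eq o x
    have h5 : IsGeodesicOn γ 0 (min T (dist o x)) := fun s hs t ht =>
      h1 s ⟨hs.1, hs.2.trans (min_le_right _ _)⟩ t ⟨ht.1, ht.2.trans (min_le_right _ _)⟩
    have h6 := hX.extGeodesic_of_isGeodesicOn h5 (le_min T.2 dist_nonneg) s
    rw [h2] at h6
    rw [h4 T, h6, h4, NNReal.coe_min, min_assoc]
  · change hX.extGeodesic o (c.1 T) s = c.1 (min s T)
    have h1 : IsGeodesicOn (fun t : ℝ => c.1 t.toNNReal) 0 T := fun s hs t ht => by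
      rw [c.2.2.dist_eq, NNReal.dist_eq, Real.coe_toNNReal _ hs.1, Real.coe_toNNReal _ ht.1]
    have h2 := hX.extGeodesic_of_isGeodesicOn h1 T.2 s
    simp only [Real.toNNReal_zero, c.2.1, Real.toNNReal_coe] at h2
    rw [h2, ← NNReal.coe_min, Real.toNNReal_coe]

theorem dist_extGeodesic_le (o x y : X) (s : ℝ≥0) :
    dist (hX.extGeodesic o x s) (hX.extGeodesic o y s) ≤ 2 * dist x y := by
  wlog hle : dist o x ≤ dist o y generalizing x y
  · rw [dist_comm, dist_comm x]
    exact this y x (le_of_not_ge hle)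
  obtain ⟨γ, h1, h2, h3, h4⟩ := hX.exists_extGeodesic_eq o x
  obtain ⟨γ', h1', h2', h3', h4'⟩ := hX.exists_extGeodesic_eq o y
  have htri : dist o y - dist o x ≤ dist x y := by linarith [dist_triangle o x y]
  rw [h4, h4']
  set a := dist o x with ha
  set b := dist o y with hb
  have ha0 : 0 ≤ a := dist_nonneg
  have hb0 : 0 ≤ b := dist_nonneg
  have hs0 : (0 : ℝ) ≤ s := s.2
  have hxy : 0 ≤ dist x y := dist_nonneg
  -- Convexity compares the geodesics at proportional times `l a` and `l b`, not at equal times.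
  -- Correcting the time on the longer one costs at most `b - a ≤ dist x y`, whence the factor `2`.
  obtain ⟨l, hl0, hl1, hla, hlb⟩ : ∃ l : ℝ, 0 ≤ l ∧ l ≤ 1 ∧ l * a = min (s : ℝ) a ∧
      |l * b - min (s : ℝ) b| ≤ b - a := by
    rcases le_total (s : ℝ) a with h | h
    · rw [min_eq_left h, min_eq_left (h.trans hle)]
      rcases ha0.eq_or_lt with h0 | h0
      · have hs : (s : ℝ) = 0 := le_antisymm (h0 ▸ h) hs0
        refine ⟨0, le_rfl, zero_le_one, by rw [hs, zero_mul], ?_⟩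
        rw [hs, zero_mul, sub_zero, abs_zero]; linarith
      · refine ⟨s / a, by positivity, div_le_one_of_le₀ h ha0, div_mul_cancel₀ _ h0.ne', ?_⟩
        have : s / a * b - s = s / a * (b - a) := by field_simp
        rw [this, abs_of_nonneg (mul_nonneg (by positivity) (by linarith))]
        exact mul_le_of_le_one_left (by linarith) (div_le_one_of_le₀ h ha0)
    · refine ⟨1, zero_le_one, le_rfl, by rw [min_eq_right h, one_mul], ?_⟩
      rw [one_mul, abs_of_nonneg (sub_nonneg.2 (min_le_right _ _))]
      linarith [le_min h hle]
  have hA := hX.dist_le_mul_dist h1 h1' (h2.trans h2'.symm) ha0 hb0 hl0 hl1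
  rw [h3, h3', hla] at hA
  have hB : dist (γ' (l * b)) (γ' (min s b)) ≤ b - a := by
    rw [h1' _ ⟨mul_nonneg hl0 hb0, mul_le_of_le_one_left hb0 hl1⟩ _
      ⟨le_min hs0 hb0, min_le_right _ _⟩]
    exact hlb
  have hC : l * dist x y ≤ dist x y := mul_le_of_le_one_left hxy hl1
  linarith [dist_triangle (γ (min s a)) (γ' (l * b)) (γ' (min s b))]

theorem continuous_extGeodesic (o : X) : Continuous (hX.extGeodesic o) := by
  refine ContinuousMap.continuous_of_continuous_uncurry _ (continuous_iff_continuousAt.2 ?_)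
  rintro ⟨x, s⟩
  change Tendsto (fun q : X × ℝ≥0 => hX.extGeodesic o q.1 q.2) (𝓝 (x, s))
    (𝓝 (hX.extGeodesic o x s))
  have h1 : Tendsto (fun q : X × ℝ≥0 => hX.extGeodesic o x q.2) (𝓝 (x, s))
      (𝓝 (hX.extGeodesic o x s)) :=
    ((hX.extGeodesic o x).continuous.tendsto s).comp (continuous_snd.tendsto (x, s))
  refine h1.congr_dist (squeeze_zero (fun _ => dist_nonneg)
    (fun q => hX.dist_extGeodesic_le o x q.1 q.2) ?_)
  have h2 : Continuous fun q : X × ℝ≥0 => 2 * dist x q.1 := by fun_prop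
  simpa using h2.tendsto (x, s)

omit hX in
-- Arzelà–Ascoli: rays are `1`-Lipschitz, their values at time `t` lie in the compact ball of radius
-- `t`, and the defining conditions are closed pointwise.
theorem isCompact_visualBoundary [ProperSpace X] (o : X) :
    IsCompact {c : C(ℝ≥0, X) | c 0 = o ∧ Isometry c} := by
  refine ArzelaAscoli.isCompact_of_equicontinuous _ ?_ ?_
  · have himg : ContinuousMap.toFun '' {c : C(ℝ≥0, X) | c 0 = o ∧ Isometry c} =
        {f : ℝ≥0 → X | f 0 = o ∧ Isometry f} := by
      ext f
      constructor
      · rintro ⟨c, hc, rfl⟩; exact hc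
      · intro hf; exact ⟨⟨f, hf.2.continuous⟩, hf, rfl⟩
    rw [himg]
    refine (isCompact_univ_pi fun t : ℝ≥0 => isCompact_closedBall o (t : ℝ)).of_isClosed_subset
      ?_ ?_
    · have : {f : ℝ≥0 → X | f 0 = o ∧ Isometry f} = {f : ℝ≥0 → X | f 0 = o} ∩
          ⋂ s, ⋂ t, {f : ℝ≥0 → X | dist (f s) (f t) = dist s t} := by
        ext f; simp [isometry_iff_dist_eq]
      rw [this]
      refine (isClosed_eq (continuous_apply 0) continuous_const).inter
        (isClosed_iInter fun s => isClosed_iInter fun t => isClosed_eq ?_ continuous_const)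
      exact (continuous_apply s).dist (continuous_apply t)
    · rintro f ⟨h0, hf⟩ t -
      rw [Metric.mem_closedBall]
      nth_rewrite 1 [← h0]
      rw [hf.dist_eq, NNReal.dist_eq]
      simp
  · refine Metric.equicontinuous_of_continuity_modulus (fun r => r) tendsto_id _ ?_
    rintro s t ⟨c, hc⟩
    exact (hc.2.dist_eq s t).le

theorem isCombed [ProperSpace X] (o : X) : (hX.bordification o).IsCombed where
  continuous_point := by
    have h1 : Continuous fun z : (hX.bordification o).Total => hX.toPath o z :=
      continuous_induced_dom
    exact ContinuousEval.continuous_eval.comp (h1.prodMap continuous_id)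
  continuous_incl := continuous_induced_rng.2 (hX.continuous_extGeodesic o)
  tendsto_incl_point z := by
    have h1 : Continuous fun z : (hX.bordification o).Total => hX.toPath o z :=
      continuous_induced_dom
    have h2 : IsInducing fun z : (hX.bordification o).Total => hX.toPath o z := ⟨rfl⟩
    rw [h2.tendsto_nhds_iff, ContinuousMap.tendsto_iff_forall_isCompact_tendstoUniformlyOn]
    intro K hK
    have h3 : Tendsto (fun q : (hX.bordification o).Total × ℝ≥0 => hX.toPath o q.1)
        (𝓝 z ×ˢ atTop) (𝓝 (hX.toPath o z)) := (h1.tendsto z).comp tendsto_fst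
    rw [ContinuousMap.tendsto_iff_forall_isCompact_tendstoUniformlyOn] at h3
    refine (h3 K hK).congr ?_
    obtain ⟨T, hT⟩ := hK.bddAbove
    filter_upwards [tendsto_snd.eventually (eventually_ge_atTop T)] with q hq s hs
    refine Eq.trans ?_ (hX.extGeodesic_toPath q.1 q.2 s).symm
    rw [min_eq_left ((hT hs).trans hq)]
  dist_point_incl x t := hX.dist_extGeodesic_base o x t
  dist_point_bdry w t := by
    obtain ⟨c, hc0, hc⟩ := w
    refine (congrArg (dist (c t)) hc0.symm).trans ?_
    rw [hc.dist_eq, NNReal.dist_eq]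
    simp
  point_incl x t ht := hX.extGeodesic_eq_self ht
  bdry_ext v w h := Subtype.ext (ContinuousMap.ext h)
  isCompact_bdry := by
    have h2 : IsInducing fun z : (hX.bordification o).Total => hX.toPath o z := ⟨rfl⟩
    rw [h2.isCompact_iff]
    convert isCompact_visualBoundary o using 1
    ext c
    constructor
    · rintro ⟨_, ⟨w, rfl⟩, rfl⟩; exact w.2
    · intro hc; exact ⟨_, ⟨⟨c, hc⟩, rfl⟩, rfl⟩

end IsBusemannSpace

/-! ### Neighbourhoods of open cones -/

namespace OpenCone

variable {E : Type u} [NormedAddCommGroup E] [InnerProductSpace ℝ E]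

theorem shrink_eq (v : E) : shrink v = (1 + ‖v‖)⁻¹ • v := by
  rcases eq_or_ne v 0 with rfl | hv
  · simp [shrink]
  · have := norm_ne_zero_iff.2 hv
    rw [shrink, smul_smul]
    congr 1
    field_simp

theorem norm_shrink (v : E) : ‖shrink v‖ = ‖v‖ / (1 + ‖v‖) := by
  rw [shrink_eq, norm_smul, norm_inv, Real.norm_of_nonneg (by positivity), inv_mul_eq_div]

theorem continuous_shrink : Continuous (shrink : E → E) := by
  rw [funext shrink_eq]
  exact ((continuous_const.add continuous_norm).inv₀ fun v =>
    (add_pos_of_pos_of_nonneg one_pos (norm_nonneg v)).ne').smul continuous_id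

variable {W : Set E} (hS : W ⊆ Metric.sphere 0 1) (hne : W.Nonempty) (d : ℝ)

theorem norm_truncate {v : E} {t : ℝ} (ht : 0 ≤ t) :
    ‖min t ‖v‖ • (‖v‖⁻¹ • v)‖ = min t ‖v‖ := by
  rcases eq_or_ne v 0 with rfl | hv
  · simp [ht]
  · rw [norm_smul, norm_smul, norm_inv, norm_norm, inv_mul_cancel₀ (norm_ne_zero_iff.2 hv), mul_one,
      Real.norm_of_nonneg (le_min ht (norm_nonneg v))]

theorem truncate_eq_self {v : E} {t : ℝ} (ht : ‖v‖ ≤ t) : min t ‖v‖ • (‖v‖⁻¹ • v) = v := by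
  rcases eq_or_ne v 0 with rfl | hv
  · simp
  · rw [min_eq_right ht, smul_inv_smul₀ (norm_ne_zero_iff.2 hv)]

include hS in
/-- The extended geodesics in terms of the ball model. -/
theorem geo_eq (z : Pen W d ⊕ W) (t : ℝ≥0) : (geo W hne d z t : E) =
    ((t : ℝ) / max ‖toBall W d z‖ (t * (1 - ‖toBall W d z‖))) • toBall W d z := by
  rcases z with v | w
  · change min (t : ℝ) ‖(v : E)‖ • (‖(v : E)‖⁻¹ • (v : E)) =
      ((t : ℝ) / max ‖shrink (v : E)‖ (t * (1 - ‖shrink (v : E)‖))) • shrink (v : E)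
    rw [norm_shrink, shrink_eq]
    rcases eq_or_ne (v : E) 0 with hv | hv
    · simp [hv]
    · have hr : 0 < ‖(v : E)‖ := norm_pos_iff.2 hv
      set r := ‖(v : E)‖
      have hm : max (r / (1 + r)) (t * (1 - r / (1 + r))) = max r t / (1 + r) := by
        rw [← max_div_div_right (by positivity)]
        congr 1
        field_simp
        ring
      have hM : 0 < max r t := lt_max_of_lt_left hr
      rw [hm, smul_smul, smul_smul]
      congr 1
      have : min (t : ℝ) r * max r t = t * r := by rw [max_comm, min_mul_max]
      field_simp
      linarith
  · have hw : ‖(w : E)‖ = 1 := by simpa using hS w.2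
    change (t : ℝ) • (w : E) = ((t : ℝ) / max ‖(w : E)‖ (t * (1 - ‖(w : E)‖))) • (w : E)
    rw [hw]
    simp

include hS in
theorem dist_toBall_geo_le (z : Pen W d ⊕ W) (t : ℝ≥0) :
    dist (toBall W d (.inl (geo W hne d z t))) (toBall W d z) ≤ (1 + (t : ℝ))⁻¹ := by
  have ht : (0 : ℝ) ≤ t := t.2
  rcases z with v | w
  · change dist (shrink (min (t : ℝ) ‖(v : E)‖ • (‖(v : E)‖⁻¹ • (v : E)))) (shrink (v : E)) ≤ _
    rcases le_total ‖(v : E)‖ t with h | h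
    · rw [truncate_eq_self h, dist_self]; positivity
    · rcases eq_or_ne (v : E) 0 with hv | hv
      · rw [hv]; simp [shrink]; positivity
      rw [shrink_eq, shrink_eq, norm_truncate ht, min_eq_left h, dist_eq_norm, smul_smul, smul_smul,
        ← sub_smul, norm_smul]
      have hr : 0 < ‖(v : E)‖ := norm_pos_iff.2 hv
      generalize ‖(v : E)‖ = r at h hr ⊢
      have h1 : ‖(1 + (t : ℝ))⁻¹ * (t * r⁻¹) - (1 + r)⁻¹‖ * r =
          |(1 + r)⁻¹ - (1 + (t : ℝ))⁻¹| := by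
        rw [Real.norm_eq_abs, ← abs_of_pos hr, ← abs_mul, abs_of_pos hr]
        congr 1
        field_simp
        ring
      rw [mul_assoc, h1, abs_le]
      have h2 : (1 + r)⁻¹ ≤ (1 + (t : ℝ))⁻¹ := by gcongr
      have h3 : 0 < (1 + r)⁻¹ := by positivity
      constructor <;> linarith
  · have hw : ‖(w : E)‖ = 1 := by simpa using hS w.2
    change dist (shrink ((t : ℝ) • (w : E))) (w : E) ≤ _
    rw [shrink_eq, norm_smul, hw, mul_one, Real.norm_of_nonneg ht, smul_smul, dist_eq_norm]
    nth_rewrite 2 [← one_smul ℝ (w : E)]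
    rw [← sub_smul, norm_smul, hw, mul_one, Real.norm_eq_abs]
    have : (1 + (t : ℝ))⁻¹ * t - 1 = -(1 + (t : ℝ))⁻¹ := by field_simp; ring
    rw [this, abs_neg, abs_of_nonneg (by positivity)]

theorem norm_smul_div_max_le {t : ℝ} (ht : 0 ≤ t) (b : E) :
    ‖(t / max ‖b‖ (t * (1 - ‖b‖))) • b‖ ≤ t := by
  have hm : 0 ≤ max ‖b‖ (t * (1 - ‖b‖)) := (norm_nonneg _).trans (le_max_left _ _)
  rw [norm_smul, Real.norm_of_nonneg (div_nonneg ht hm), div_mul_eq_mul_div]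
  exact div_le_of_le_mul₀ hm ht (mul_le_mul_of_nonneg_left (le_max_left _ _) ht)

theorem isInducing_toBall : IsInducing fun z : (bordification W hne d).Total => toBall W d z := ⟨rfl⟩

include hS in
theorem isCombed (hW : IsCompact W) : (bordification W hne d).IsCombed where
  continuous_point := by
    have hb : Continuous fun q : (bordification W hne d).Total × ℝ≥0 => toBall W d q.1 :=
      (isInducing_toBall hne d).continuous.comp continuous_fst
    have ht : Continuous fun q : (bordification W hne d).Total × ℝ≥0 => (q.2 : ℝ) :=
      NNReal.continuous_coe.comp continuous_snd
    refine Topology.IsInducing.subtypeVal.continuous_iff.2 ?_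
    change Continuous fun q : (bordification W hne d).Total × ℝ≥0 => (geo W hne d q.1 q.2 : E)
    rw [funext fun q : (bordification W hne d).Total × ℝ≥0 => geo_eq hS hne d q.1 q.2]
    rw [continuous_iff_continuousAt]
    rintro ⟨z, t⟩
    -- The denominator vanishes only at the apex at time `0`, where the norm bound by `t` gives
    -- continuity.
    by_cases h0 : max ‖toBall W d z‖ (t * (1 - ‖toBall W d z‖)) = 0
    · have hz : ‖toBall W d z‖ = 0 := le_antisymm ((le_max_left _ _).trans h0.le) (norm_nonneg _)
      have ht0 : (t : ℝ) = 0 := by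
        refine le_antisymm ?_ t.2
        have := (le_max_right _ _).trans h0.le
        rwa [hz, sub_zero, mul_one] at this
      have hval : ((t : ℝ) / max ‖toBall W d z‖ (t * (1 - ‖toBall W d z‖))) • toBall W d z = 0 := by
        rw [ht0, zero_div, zero_smul]
      have ht' := ht.tendsto (z, t)
      simp only [ht0] at ht'
      refine (congrArg (Tendsto _ (𝓝 (z, t))) (congrArg 𝓝 hval)).mpr
        (squeeze_zero_norm (fun q => norm_smul_div_max_le q.2.2 _) ht')
    · exact ((ht.continuousAt.div (hb.norm.max (ht.mul (continuous_const.sub hb.norm))).continuousAt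
        h0).smul hb.continuousAt)
  continuous_incl :=
    (isInducing_toBall hne d).continuous_iff.2 (continuous_shrink.comp continuous_subtype_val)
  tendsto_incl_point z := by
    rw [(isInducing_toBall hne d).tendsto_nhds_iff]
    have h1 : Tendsto (fun q : (bordification W hne d).Total × ℝ≥0 => toBall W d q.1)
        (𝓝 z ×ˢ atTop) (𝓝 (toBall W d z)) :=
      ((isInducing_toBall hne d).continuous.tendsto z).comp tendsto_fst
    refine h1.congr_dist (squeeze_zero (fun _ => dist_nonneg)
      (fun q => (dist_comm _ _).trans_le (dist_toBall_geo_le hS hne d q.1 q.2)) ?_)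
    exact tendsto_inv_atTop_zero.comp (tendsto_atTop_add_const_left _ _
      (NNReal.tendsto_coe_atTop.2 tendsto_snd))
  dist_point_incl := by
    rintro ⟨x, hx⟩ t
    change dist (min (t : ℝ) ‖x‖ • (‖x‖⁻¹ • x)) 0 = min (t : ℝ) (dist x 0)
    rw [dist_zero_right, dist_zero_right]
    exact norm_truncate t.2
  dist_point_bdry := by
    rintro ⟨w, hw⟩ t
    have hw1 : ‖w‖ = 1 := by simpa using hS hw
    change dist ((t : ℝ) • w) 0 = t
    rw [dist_zero_right, norm_smul, hw1, mul_one]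
    exact Real.norm_of_nonneg t.2
  point_incl := by
    rintro ⟨x, hx⟩ t ht
    change dist x 0 ≤ t at ht
    rw [dist_zero_right] at ht
    exact Subtype.ext (truncate_eq_self ht)
  bdry_ext := by
    rintro ⟨v, hv⟩ ⟨w, hw⟩ h
    have h1 : ((1 : ℝ≥0) : ℝ) • v = ((1 : ℝ≥0) : ℝ) • w := congrArg Subtype.val (h 1)
    exact Subtype.ext (by simpa using h1)
  isCompact_bdry := by
    rw [(isInducing_toBall hne d).isCompact_iff]
    convert hW using 1
    ext c
    constructor
    · rintro ⟨_, ⟨w, rfl⟩, rfl⟩; exact w.2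
    · intro hc; exact ⟨_, ⟨⟨c, hc⟩, rfl⟩, rfl⟩

end OpenCone

/-! ### Conclusion for the given factors -/

theorem Factor.isCombed (F : Factor.{u}) : F.bordification.IsCombed := by
  cases F with
  | busemann X hX o => exact hX.isCombed o
  | cone E W hW hS hne d hd => exact OpenCone.isCombed hS hne d hW

theorem mainTheorem5 (n : ℕ) [NeZero n] (F : Fin n → Factor.{u})
    (B : Fin n → Bordification.{u}) (hB : ∀ i, B i = (F i).bordification) :
    IsCompactificationAtInfinity (Bordification.embedClosure B) ∧
    Bordification.prodClosure B =
      Set.range (Bordification.embed B) ∪ FiniteJoin.sub (fun i => (B i).bdry) ∧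
    ContractibleSpace (Bordification.prodClosure B) ∧
    ∃ H : C(Bordification.prodClosure B × ℝ≥0∞, Bordification.prodClosure B),
      (∀ (p : FiniteJoin.Omega fun i => (B i).Total)
        (hp : FiniteJoin.mk p ∈ Bordification.prodClosure B) (t : ℝ≥0),
        H (⟨FiniteJoin.mk p, hp⟩, (t : ℝ≥0∞)) = Bordification.embedClosure B
          (WithLp.toLp 1 fun i => (B i).point (p.1 i).2 (unitInterval.toNNReal (p.1 i).1 * t))) ∧
      (∀ z, H (z, 0) = Bordification.embedClosure B (WithLp.toLp 1 fun i => (B i).base)) ∧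
      (∀ z, H (z, ⊤) = z) := by
  have hC : ∀ i, (B i).IsCombed := fun i => hB i ▸ (F i).isCombed
  exact ⟨Bordification.isCompactificationAtInfinity_embedClosure hC,
    (Bordification.prodClosure_eq_balanced hC).trans Bordification.balanced_eq,
    Bordification.contractibleSpace_prodClosure hC,
    ⟨Bordification.contraction B, Bordification.continuous_contraction hC⟩,
    Bordification.contraction_coe hC, Bordification.contraction_zero hC,
    Bordification.contraction_top⟩
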